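/- Let $M$ be a compact orientable $C^\infty$ surface without boundary, equipped with a $C^\infty$ Riemannian metric, and fix an orientation of $M$. Let $\Phi$ be the geodesic flow on the unit tangent bundle $SM$, and suppose that $\Phi$ is equicontinuous: for a metric $d$ inducing the topology of $SM$ (equivalently, for every such metric), for every $\varepsilon>0$ there is $\delta>0$ such that $d(v,w)<\delta$ implies $d(\Phi_t(v),\Phi_t(w))<\varepsilon$ for all $t\in\mathbb R$. Let $\gamma:\mathbb R\to M$ be a simple closed geodesic, parametrized by arc length, of length $\ell$. Let $A\subset SM$ be the set of all unit vectors that are based at a point of $\gamma$ and point strictly to the left of $\gamma$. For $v\in A$ based at $\gamma(t)$, let $\theta(v)\in(0,1)$ be the angle between $\dot\gamma(t)$ and $v$ divided by $\pi$, and put $$\iota(v)=\bigl(\sin(\pi\theta(v))\cos(2\pi t/\ell),\ \sin(\pi\theta(v))\sin(2\pi t/\ell),\ \cos(\pi\theta(v))\bigr)\in S^2 .$$ Then: 1. $\iota$ is a homeomorphism of $A$ onto $S^2\setminus\{(0,0,1),(0,0,-1)\}$; thus $A$ is an open annulus and $S^2$ is its two-point compactification. 2. For every $v\in A$ there is a least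 time $\tau(v)>0$ with $\Phi_{\tau(v)}(v)\in A$, so the geodesic return map $F:A\to A$, $F(v)=\Phi_{\tau(v)}(v)$, is defined. 3. Under $\iota$, the map $F$ extends to a homeomorphism $\hat F:S^2\to S^2$ (that is, $\hat F\circ\iota=\iota\circ F$) that fixes the two points $(0,0,\pm1)$. 4. $\hat F$ is recurrent: there is a sequence of natural numbers $n_k\to\infty$ such that $\sup_{x\in S^2} d(\hat F^{n_k}(x),x)\to 0$ as $k\to\infty$, where $d$ is the Euclidean distance on $S^2$. -/

import Mathlib

open Set Filter Topology Bundle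
open scoped Manifold ContDiff

noncomputable section

-- the standard charted space structure of a model space is to be preferred over that of `TopCat.of`
attribute [local instance 2000] chartedSpaceSelf

namespace GeodesicReturn

/-- An equicontinuous flow: with respect to a metric inducing the topology of `X`, for every
`ε > 0` there is `δ > 0` such that `δ`-close points stay `ε`-close for all times.
(On a compact space this does not depend on the metric.) -/
def IsEquicontinuousFlow {X : Type*} [inst : TopologicalSpace X] (Φ : Flow ℝ X) : Prop :=
  ∃ m : MetricSpace X, m.toPseudoMetricSpace.toUniformSpace.toTopologicalSpace = inst ∧
    ∀ ε > 0, ∃ δ > 0, ∀ x y : X, m.dist x y < δ → ∀ t : ℝ, m.dist (Φ t x) (Φ t y) < ε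

/-- A continuous self-map `f` of a metric space is recurrent if there are `n_k → ∞` with
`sup_x d(f^{n_k}(x), x) → 0`; the supremum is taken in `[0, ∞]`. -/
def IsRecurrent {X : Type*} [MetricSpace X] (f : X → X) : Prop :=
  Continuous f ∧ ∃ n : ℕ → ℕ, Tendsto n atTop atTop ∧
    Tendsto (fun k => ⨆ x, edist (f^[n k] x) x) atTop (𝓝 0)

/-- The Euclidean plane, on which surfaces are modelled. -/
abbrev Plane : Type := EuclideanSpace ℝ (Fin 2)

/-- The round sphere `S²`. -/
abbrev S2 : Type := Metric.sphere (0 : EuclideanSpace ℝ (Fin 3)) 1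

section Surface

variable {M : Type*} [TopologicalSpace M] [ChartedSpace Plane M]

/-- An oriented atlas: smooth charts covering `M` whose transition maps have positive Jacobian
determinant. A surface is orientable if and only if it has one. -/
structure IsOrientedAtlas [IsManifold (𝓡 2) ∞ M] (𝒜 : Set (OpenPartialHomeomorph M Plane)) :
    Prop where
  subset_maximalAtlas : 𝒜 ⊆ IsManifold.maximalAtlas (𝓡 2) ∞ M
  covers : ∀ x : M, ∃ e ∈ 𝒜, x ∈ e.source
  det_pos : ∀ e ∈ 𝒜, ∀ e' ∈ 𝒜, ∀ x ∈ e.source ∩ e'.source,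
    0 < (fderiv ℝ (e' ∘ e.symm) (e x)).det

/-- The pair `(u, w)` of tangent vectors at `x` is a positively oriented basis. -/
def IsPositivePair [IsManifold (𝓡 2) ∞ M] (𝒜 : Set (OpenPartialHomeomorph M Plane)) (x : M)
    (u w : TangentSpace (𝓡 2) x) : Prop :=
  ∃ e ∈ 𝒜, x ∈ e.source ∧
    let a : Plane := mfderiv (𝓡 2) (𝓡 2) e x u
    let b : Plane := mfderiv (𝓡 2) (𝓡 2) e x w
    0 < a 0 * b 1 - a 1 * b 0

/-- The velocity vector of a curve. -/
def velocity (γ : ℝ → M) (t : ℝ) : TangentSpace (𝓡 2) (γ t) :=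
  mfderiv 𝓘(ℝ, ℝ) (𝓡 2) γ t (1 : ℝ)

variable [RiemannianBundle (fun x : M => TangentSpace (𝓡 2) x)]

/-- The Riemannian metric in the chart at `p`: the value at the coordinate point `y` on the
coordinate vectors `u`, `w`. -/
def chartMetric (p : M) (y u w : Plane) : ℝ :=
  let φ : Plane → M := (extChartAt (𝓡 2) p).symm
  inner ℝ (mfderiv (𝓡 2) (𝓡 2) φ y u : TangentSpace (𝓡 2) (φ y))
    (mfderiv (𝓡 2) (𝓡 2) φ y w : TangentSpace (𝓡 2) (φ y))

/-- The Christoffel symbols of the first kind in the chart at `p`: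
`Γ(u, v; w) = (∂_u g(v, w) + ∂_v g(u, w) - ∂_w g(u, v)) / 2`. -/
def christoffel (p : M) (y u v w : Plane) : ℝ :=
  (fderiv ℝ (fun z => chartMetric p z v w) y u + fderiv ℝ (fun z => chartMetric p z u w) y v
    - fderiv ℝ (fun z => chartMetric p z u v) y w) / 2

/-- A geodesic parametrized by arc length and defined for all times: a smooth curve of unit speed
which in charts satisfies the geodesic equation `c'' + Γ(c', c') = 0`, written with the index
lowered by the metric. -/
structure IsGeodesic [IsManifold (𝓡 2) ∞ M] (γ : ℝ → M) : Prop where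
  smooth : ContMDiff 𝓘(ℝ, ℝ) (𝓡 2) ∞ γ
  unit_speed : ∀ t, ‖velocity γ t‖ = 1
  equation : ∀ (p : M) (t : ℝ), γ t ∈ (chartAt Plane p).source →
    let c : ℝ → Plane := fun s => extChartAt (𝓡 2) p (γ s)
    ∀ w : Plane, chartMetric p (c t) (deriv (deriv c) t) w
      + christoffel p (c t) (deriv c t) (deriv c t) w = 0

/-- A simple closed geodesic of length `ℓ`. -/
structure IsSimpleClosedGeodesic [IsManifold (𝓡 2) ∞ M] (γ : ℝ → M) (ℓ : ℝ) : Prop where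
  geodesic : IsGeodesic γ
  length_pos : 0 < ℓ
  periodic : Function.Periodic γ ℓ
  simple : InjOn γ (Ico 0 ℓ)

variable (M) in
/-- The unit tangent bundle `SM`, with the topology induced from `TM`. -/
abbrev UnitTangent [IsManifold (𝓡 2) ∞ M] : Type _ :=
  {v : TangentBundle (𝓡 2) M // ‖v.2‖ = 1}

/-- `Φ` is the geodesic flow on `SM`: each orbit consists of the velocity vectors of the geodesic
to which its initial point is tangent. -/
def IsGeodesicFlow [IsManifold (𝓡 2) ∞ M] (Φ : Flow ℝ (UnitTangent M)) : Prop :=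
  ∀ v : UnitTangent M, IsGeodesic (fun t => (Φ t v).1.proj) ∧
    ∀ t, (Φ t v).1 = ⟨(Φ t v).1.proj, velocity (fun s => (Φ s v).1.proj) t⟩

/-- `v` is a unit vector `w` based at `γ t` and pointing strictly to the left of `γ`. -/
def IsLeftVector [IsManifold (𝓡 2) ∞ M] (𝒜 : Set (OpenPartialHomeomorph M Plane)) (γ : ℝ → M)
    (v : UnitTangent M) (t : ℝ) (w : TangentSpace (𝓡 2) (γ t)) : Prop :=
  v.1 = ⟨γ t, w⟩ ∧ IsPositivePair 𝒜 (γ t) (velocity γ t) w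

/-- The annulus of the unit vectors along `γ` pointing strictly to the left of `γ`. -/
def annulus [IsManifold (𝓡 2) ∞ M] (𝒜 : Set (OpenPartialHomeomorph M Plane)) (γ : ℝ → M) :
    Set (UnitTangent M) :=
  {v | ∃ (t : ℝ) (w : TangentSpace (𝓡 2) (γ t)), IsLeftVector 𝒜 γ v t w}

/-- The point of `S²` with colatitude `α` and longitude `β`. -/
def spherePoint (α β : ℝ) : S2 :=
  ⟨!₂[Real.sin α * Real.cos β, Real.sin α * Real.sin β, Real.cos α], by
    rw [mem_sphere_zero_iff_norm, EuclideanSpace.norm_eq, Real.sqrt_eq_one]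
    simp only [Fin.sum_univ_three, Real.norm_eq_abs, sq_abs]
    simp only [Matrix.cons_val]
    linear_combination (Real.sin α) ^ 2 * Real.sin_sq_add_cos_sq β + Real.sin_sq_add_cos_sq α⟩

/-- The pole `θ = 0` of `S²`. -/
def northPole : S2 := spherePoint 0 0

/-- The pole `θ = 1` of `S²`. -/
def southPole : S2 := spherePoint Real.pi 0

/-- The identification of the annulus with `S²` minus the poles: the vector at `γ t` which makes
the angle `π θ`, `0 < θ < 1`, with the velocity of `γ` goes to the point of colatitude `π θ` and
longitude `2 π t / ℓ`. (The parameter `t` is unique modulo `ℓ`.) -/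
def annulusToSphere [IsManifold (𝓡 2) ∞ M] (𝒜 : Set (OpenPartialHomeomorph M Plane)) (γ : ℝ → M)
    (ℓ : ℝ) (v : annulus 𝒜 γ) : S2 :=
  let t : ℝ := v.2.choose
  let w : TangentSpace (𝓡 2) (γ t) := v.2.choose_spec.choose
  spherePoint (InnerProductGeometry.angle (velocity γ t) w) (2 * Real.pi * t / ℓ)

/-- `τ` is the first positive time at which the orbit of `v` is in `A`. -/
def IsFirstReturnTime {X : Type*} [TopologicalSpace X] (Φ : Flow ℝ X) (A : Set X) (v : X)
    (τ : ℝ) : Prop :=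
  IsLeast {s : ℝ | 0 < s ∧ Φ s v ∈ A} τ

/-- `F` is the first return map of the flow `Φ` to the set `A`: every point of `A` has a first
return time, and `F` moves the point along its orbit for this time. -/
def IsFirstReturnMap {X : Type*} [TopologicalSpace X] (Φ : Flow ℝ X) (A : Set X) (F : A → A) :
    Prop :=
  ∀ v : A, ∃ τ : ℝ, IsFirstReturnTime Φ A v τ ∧ (F v : X) = Φ τ v

end Surface

end GeodesicReturn

end

/-!
The geodesic flow crosses the annulus transversally, so equicontinuity makes the annulus a cross
section: every orbit is almost periodic, hence returns in both directions, and no orbit starting in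
the annulus can converge to its boundary, which consists of two closed orbits. The closed annulus
modulo its boundary circles is the sphere, and by equicontinuity vectors close to a boundary circle
return close to it; so the return map extends over the poles.

For recurrence, uniform almost periodicity yields times `t` at which `Φ t` is uniformly close to the
identity. On a compact connected part of the annulus such a `t` is corrected by a small continuous
amount to a return time, and this is by connectedness the `n`-th return time with the same `n` for
all points. Near the poles all iterates of the return map are close to the identity.
-/

noncomputable section

namespace GeodesicReturn

/-! ### Equicontinuous flows -/

section Equicontinuous

variable {X : Type*} [MetricSpace X] [CompactSpace X] {Φ : Flow ℝ X}

-- By Arzelà–Ascoli two of the maps `Φ (k * T)` are uniformly close; compose with the inverse of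
-- the earlier one.
theorem exists_gt_forall_dist_flow_lt (hΦ : UniformEquicontinuous fun t => Φ t) {ε : ℝ}
    (hε : 0 < ε) (R : ℝ) : ∃ t > R, ∀ x, dist (Φ t x) x < ε := by
  set T : ℝ := |R| + 1
  let f (k : ℕ) : BoundedContinuousFunction X X :=
    .mkOfCompact ⟨Φ (k * T), Φ.continuous continuous_const continuous_id⟩
  have compact : IsCompact (closure (range f)) :=
    BoundedContinuousFunction.arzela_ascoli univ isCompact_univ _ (fun _ _ _ => mem_univ _)
      fun x U hU => (hΦ.equicontinuous x U hU).mono fun _ hy ⟨_, k, hk⟩ => hk ▸ hy (k * T)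
  obtain ⟨_, -, φ, φ_mono, lim⟩ :=
    compact.tendsto_subseq fun k => subset_closure (mem_range_self k)
  obtain ⟨n, hn⟩ := Metric.cauchySeq_iff'.1 lim.cauchySeq ε hε
  refine ⟨φ (n + 1) * T - φ n * T, ?_, fun x => ?_⟩
  · have gap : (φ n : ℝ) + 1 ≤ φ (n + 1) := mod_cast φ_mono n.lt_succ_self
    nlinarith [le_abs_self R, abs_nonneg R]
  · have close : dist (Φ (φ (n + 1) * T) (Φ (-(φ n * T)) x)) (Φ (φ n * T) (Φ (-(φ n * T)) x)) < ε :=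
      (BoundedContinuousFunction.dist_coe_le_dist _).trans_lt (hn (n + 1) n.le_succ)
    rwa [← Φ.map_add, ← Φ.map_add, add_neg_cancel, Φ.map_zero_apply, ← sub_eq_add_neg] at close

theorem exists_pos_forall_dist_flow_lt (Φ : Flow ℝ X) {ε : ℝ} (hε : 0 < ε) :
    ∃ ρ > 0, ∀ s, |s| < ρ → ∀ x, dist (Φ s x) x < ε := by
  have near_zero : ∀ᶠ s in 𝓝 (0 : ℝ), ∀ x ∈ univ, dist (Φ s x) x < ε :=
    isCompact_univ.eventually_forall_of_forall_eventually fun x _ =>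
      ((Φ.continuous continuous_fst continuous_snd).dist continuous_snd).continuousAt.eventually
        (gt_mem_nhds (by simpa using hε))
  obtain ⟨ρ, hρ, close⟩ := Metric.eventually_nhds_iff.1 near_zero
  exact ⟨ρ, hρ, fun s hs x => close (by simpa using hs) x (mem_univ x)⟩

end Equicontinuous

/-! ### Cross sections and their return maps -/

/-- A global cross section of a flow which need not be closed: near every point of `A` the orbits
cross `A`, at most once in a short time; orbits of points of `A` do not meet the frontier of `A`;
and they come back to `A` both in the future and in the past. -/
structure IsCrossSection {X : Type*} [TopologicalSpace X] (Φ : Flow ℝ X) (A : Set X) : Prop where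
  hit : ∀ v ∈ A, ∀ ε > 0, ∀ᶠ u in 𝓝 v, ∃ s, |s| < ε ∧ Φ s u ∈ A
  unique_hit : ∀ v ∈ A, ∃ ε > 0, ∀ᶠ u in 𝓝 v, {s | |s| < ε ∧ Φ s u ∈ A}.Subsingleton
  mem_of_mem_closure : ∀ v ∈ A, ∀ t, Φ t v ∈ closure A → Φ t v ∈ A
  exists_pos : ∀ v ∈ A, ∃ t > 0, Φ t v ∈ A
  exists_neg : ∀ v ∈ A, ∃ t < 0, Φ t v ∈ A

namespace IsCrossSection

theorem of_uniformEquicontinuous {X : Type*} [MetricSpace X] [CompactSpace X] {Φ : Flow ℝ X}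
    {A : Set X} (hΦ : UniformEquicontinuous fun t => Φ t)
    (hit : ∀ v ∈ A, ∀ ε > 0, ∀ᶠ u in 𝓝 v, ∃ s, |s| < ε ∧ Φ s u ∈ A)
    (unique_hit : ∀ v ∈ A, ∃ ε > 0, ∀ᶠ u in 𝓝 v, {s | |s| < ε ∧ Φ s u ∈ A}.Subsingleton)
    (mem_of_mem_closure : ∀ v ∈ A, ∀ t, Φ t v ∈ closure A → Φ t v ∈ A) :
    IsCrossSection Φ A := by
  have recurrent_time (v : X) (hv : v ∈ A) :
      ∃ t > 1, (∃ s, |s| < 1 ∧ Φ (s + t) v ∈ A) ∧ ∃ s, |s| < 1 ∧ Φ (s - t) v ∈ A := by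
    obtain ⟨ε, hε, near⟩ := Metric.eventually_nhds_iff.1 (hit v hv 1 one_pos)
    obtain ⟨t, ht, close⟩ := exists_gt_forall_dist_flow_lt hΦ hε 1
    have close_neg : dist (Φ (-t) v) v < ε := by
      simpa [← Φ.map_add, dist_comm] using close (Φ (-t) v)
    refine ⟨t, ht, ?_, ?_⟩
    · simpa only [Φ.map_add] using near (close v)
    · simpa only [Φ.map_add, sub_eq_add_neg] using near close_neg
  refine ⟨hit, unique_hit, mem_of_mem_closure, fun v hv => ?_, fun v hv => ?_⟩
  · obtain ⟨t, ht, ⟨s, hs, hsA⟩, -⟩ := recurrent_time v hv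
    exact ⟨s + t, by linarith [(abs_lt.1 hs).1], hsA⟩
  · obtain ⟨t, ht, -, s, hs, hsA⟩ := recurrent_time v hv
    exact ⟨s - t, by linarith [(abs_lt.1 hs).2], hsA⟩

variable {X : Type*} [TopologicalSpace X] {Φ : Flow ℝ X} {A : Set X}

theorem reverse (h : IsCrossSection Φ A) : IsCrossSection Φ.reverse A where
  hit v hv ε hε := by
    filter_upwards [h.hit v hv ε hε] with u ⟨s, hs, hsA⟩
    exact ⟨-s, by simpa using hs, by simpa using hsA⟩
  unique_hit v hv := by
    obtain ⟨ε, hε, unique⟩ := h.unique_hit v hv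
    refine ⟨ε, hε, unique.mono fun u hu s hs s' hs' => neg_injective (hu ?_ ?_)⟩
    · exact ⟨by simpa using hs.1, hs.2⟩
    · exact ⟨by simpa using hs'.1, hs'.2⟩
  mem_of_mem_closure v hv t := h.mem_of_mem_closure v hv (-t)
  exists_pos v hv := by
    obtain ⟨t, ht, htA⟩ := h.exists_neg v hv
    exact ⟨-t, neg_pos.2 ht, by simpa using htA⟩
  exists_neg v hv := by
    obtain ⟨t, ht, htA⟩ := h.exists_pos v hv
    exact ⟨-t, neg_neg_of_pos ht, by simpa using htA⟩

theorem exists_isFirstReturnTime (h : IsCrossSection Φ A) {v : X} (hv : v ∈ A) :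
    ∃ τ, IsFirstReturnTime Φ A v τ := by
  obtain ⟨ε, hε, unique⟩ := h.unique_hit v hv
  have closed_form :
      {s : ℝ | 0 < s ∧ Φ s v ∈ A} = Ici ε ∩ (fun s => Φ s v) ⁻¹' closure A := by
    ext s
    refine ⟨fun ⟨hs, hsA⟩ => ⟨?_, subset_closure hsA⟩,
      fun ⟨hs, hsA⟩ => ⟨hε.trans_le hs, h.mem_of_mem_closure v hv s hsA⟩⟩
    by_contra hlt
    exact hs.ne' (unique.self_of_nhds ⟨by rwa [abs_of_pos hs, ← not_le], hsA⟩
      ⟨by simpa using hε, by simpa using hv⟩)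
  have closed : IsClosed {s : ℝ | 0 < s ∧ Φ s v ∈ A} := closed_form ▸
    isClosed_Ici.inter (isClosed_closure.preimage (Φ.continuous continuous_id continuous_const))
  exact ⟨_, closed.isLeast_csInf (h.exists_pos v hv) ⟨0, fun _ hs => hs.1.le⟩⟩

/-- The first return time to a cross section. -/
def returnTime (h : IsCrossSection Φ A) (v : A) : ℝ :=
  (h.exists_isFirstReturnTime v.2).choose

theorem isFirstReturnTime_returnTime (h : IsCrossSection Φ A) (v : A) :
    IsFirstReturnTime Φ A v (h.returnTime v) :=
  (h.exists_isFirstReturnTime v.2).choose_spec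

theorem returnTime_pos (h : IsCrossSection Φ A) (v : A) : 0 < h.returnTime v :=
  (h.isFirstReturnTime_returnTime v).1.1

/-- The first return map (Poincaré map) of a cross section. -/
def returnMap (h : IsCrossSection Φ A) (v : A) : A :=
  ⟨Φ (h.returnTime v) v, (h.isFirstReturnTime_returnTime v).1.2⟩

theorem isFirstReturnMap_returnMap (h : IsCrossSection Φ A) : IsFirstReturnMap Φ A h.returnMap :=
  fun v => ⟨h.returnTime v, h.isFirstReturnTime_returnTime v, rfl⟩

theorem upperSemicontinuous_returnTime (h : IsCrossSection Φ A) :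
    UpperSemicontinuous h.returnTime := by
  intro v a ha
  have pos := h.returnTime_pos v
  have flow_tendsto : ContinuousAt (fun u : A => Φ (h.returnTime v) u) v :=
    (Φ.continuous continuous_const continuous_subtype_val).continuousAt
  filter_upwards [flow_tendsto.eventually (h.hit _ (h.isFirstReturnTime_returnTime v).1.2
    (min (a - h.returnTime v) (h.returnTime v)) (lt_min (sub_pos.2 ha) pos))] with u ⟨s, hs, hsA⟩
  rw [lt_min_iff, abs_lt, abs_lt] at hs
  rw [← Φ.map_add] at hsA
  have := (h.isFirstReturnTime_returnTime u).2 ⟨by linarith [hs.2.1], hsA⟩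
  linarith [hs.1.2]

theorem lowerSemicontinuous_returnTime (h : IsCrossSection Φ A) :
    LowerSemicontinuous h.returnTime := by
  intro v a ha
  have no_hit : ∀ r ∈ Icc 0 a, ∀ᶠ q : X × ℝ in 𝓝 ((v : X), r),
      q.1 ∈ A → 0 < q.2 → Φ q.2 q.1 ∉ A := by
    intro r hr
    rcases hr.1.eq_or_lt with rfl | hr0
    · obtain ⟨ε, hε, unique⟩ := h.unique_hit v v.2
      rw [nhds_prod_eq]
      filter_upwards [unique.prod_mk (Metric.ball_mem_nhds (0 : ℝ) hε)] with q hq hqA hq0 hqA'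
      exact hq0.ne' (hq.1 ⟨by simpa using hq.2, hqA'⟩ ⟨by simpa using hε, by simpa using hqA⟩)
    · have avoids : Φ r v ∉ closure A := fun hrA =>
        ((h.isFirstReturnTime_returnTime v).2 ⟨hr0, h.mem_of_mem_closure v v.2 r hrA⟩).not_gt
          (hr.2.trans_lt ha)
      have cont : Continuous fun q : X × ℝ => Φ q.2 q.1 :=
        Φ.continuous continuous_snd continuous_fst
      filter_upwards [cont.continuousAt.preimage_mem_nhds
        (isClosed_closure.isOpen_compl.mem_nhds avoids)] with q hq _ _ hqA
      exact hq (subset_closure hqA)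
  filter_upwards [continuous_subtype_val.continuousAt.eventually
    (isCompact_Icc.eventually_forall_of_forall_eventually
      (P := fun u r => u ∈ A → 0 < r → Φ r u ∉ A) no_hit)] with u hu
  by_contra hle
  exact hu _ ⟨(h.returnTime_pos u).le, not_lt.1 hle⟩ u.2 (h.returnTime_pos u)
    (h.isFirstReturnTime_returnTime u).1.2

theorem continuous_returnTime (h : IsCrossSection Φ A) : Continuous h.returnTime :=
  continuous_iff_lower_upperSemicontinuous.2
    ⟨h.lowerSemicontinuous_returnTime, h.upperSemicontinuous_returnTime⟩

theorem continuous_returnMap (h : IsCrossSection Φ A) : Continuous h.returnMap :=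
  (Φ.continuous h.continuous_returnTime continuous_subtype_val).subtype_mk _

-- Stated for two flows, and not for `Φ.reverse`, so that it gives both inverse laws.
theorem leftInverse_returnMap {Ψ : Flow ℝ X} (h : IsCrossSection Φ A) (hΨ : IsCrossSection Ψ A)
    (reverse_eq : ∀ t x, Ψ t x = Φ (-t) x) :
    Function.LeftInverse hΨ.returnMap h.returnMap := by
  intro v
  have back (s : ℝ) : Ψ s (h.returnMap v) = Φ (h.returnTime v - s) v := by
    rw [reverse_eq, sub_eq_neg_add, Φ.map_add]
    rfl
  have first := h.isFirstReturnTime_returnTime v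
  have first_back := hΨ.isFirstReturnTime_returnTime (h.returnMap v)
  have time_eq : hΨ.returnTime (h.returnMap v) = h.returnTime v := by
    refine le_antisymm (first_back.2 ⟨first.1.1, by simp [back]⟩) ?_
    by_contra! hlt
    have := first.2 ⟨sub_pos.2 hlt, back _ ▸ first_back.1.2⟩
    linarith [first_back.1.1]
  refine Subtype.ext ((back _).trans ?_)
  rw [time_eq, sub_self, Φ.map_zero_apply]

/-- The first return map as a homeomorphism; its inverse is the return map of the reversed flow. -/
def returnHomeomorph (h : IsCrossSection Φ A) : A ≃ₜ A where
  toFun := h.returnMap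
  invFun := h.reverse.returnMap
  left_inv := h.leftInverse_returnMap h.reverse fun _ _ => rfl
  right_inv := h.reverse.leftInverse_returnMap h fun t x => by simp
  continuous_toFun := h.continuous_returnMap
  continuous_invFun := h.reverse.continuous_returnMap

/-- The time of the `n`-th return to a cross section. -/
def iterReturnTime (h : IsCrossSection Φ A) (n : ℕ) (v : A) : ℝ :=
  birkhoffSum h.returnMap h.returnTime n v

theorem iterReturnTime_succ (h : IsCrossSection Φ A) (n : ℕ) (v : A) :
    h.iterReturnTime (n + 1) v = h.iterReturnTime n v + h.returnTime (h.returnMap^[n] v) :=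
  birkhoffSum_succ _ _ _ _

theorem continuous_iterReturnTime (h : IsCrossSection Φ A) (n : ℕ) :
    Continuous (h.iterReturnTime n) := by
  unfold iterReturnTime birkhoffSum
  exact continuous_finsetSum _ fun k _ =>
    h.continuous_returnTime.comp (h.continuous_returnMap.iterate k)

theorem strictMono_iterReturnTime (h : IsCrossSection Φ A) (v : A) :
    StrictMono fun n => h.iterReturnTime n v :=
  strictMono_nat_of_lt_succ fun n => by
    rw [iterReturnTime_succ]
    exact lt_add_of_pos_right _ (h.returnTime_pos _)

theorem flow_iterReturnTime (h : IsCrossSection Φ A) (n : ℕ) (v : A) :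
    Φ (h.iterReturnTime n v) v = (h.returnMap^[n] v : A) := by
  induction n with
  | zero => simp [iterReturnTime]
  | succ n ih =>
    rw [iterReturnTime_succ, add_comm, Φ.map_add, ih, Function.iterate_succ_apply']
    rfl

-- A finite limit of the return times would be a time at which the orbit is in `closure A`, hence
-- in `A`, against the isolatedness of the crossings.
theorem tendsto_iterReturnTime_atTop (h : IsCrossSection Φ A) (v : A) :
    Tendsto (fun n => h.iterReturnTime n v) atTop atTop := by
  refine (tendsto_atTop_of_monotone (h.strictMono_iterReturnTime v).monotone).resolve_right ?_
  rintro ⟨a, lim⟩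
  have flow_lim : Tendsto (fun n => Φ (h.iterReturnTime n v) v) atTop (𝓝 (Φ a v)) :=
    ((Φ.continuous continuous_id continuous_const).tendsto a).comp lim
  have limit_mem : Φ a v ∈ A := h.mem_of_mem_closure v v.2 a <| mem_closure_of_tendsto flow_lim <|
    .of_forall fun n => h.flow_iterReturnTime n v ▸ (h.returnMap^[n] v).2
  obtain ⟨ε, hε, unique⟩ := h.unique_hit _ limit_mem
  obtain ⟨n, hn⟩ := Metric.tendsto_atTop.1 lim ε hε
  have hits (k : ℕ) (hk : n ≤ k) :
      h.iterReturnTime k v - a ∈ {s | |s| < ε ∧ Φ s (Φ a v) ∈ A} := by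
    refine ⟨hn k hk, ?_⟩
    rw [← Φ.map_add, sub_add_cancel, h.flow_iterReturnTime]
    exact (h.returnMap^[k] v).2
  exact (h.strictMono_iterReturnTime v n.lt_succ_self).ne
    (sub_left_injective (unique.self_of_nhds (hits n le_rfl) (hits _ n.le_succ)))

theorem exists_iterReturnTime_eq (h : IsCrossSection Φ A) (v : A) {s : ℝ} (hs : 0 < s)
    (hsA : Φ s v ∈ A) : ∃ n, h.iterReturnTime n v = s := by
  obtain ⟨n, lt, le⟩ := (h.strictMono_iterReturnTime v).exists_between_of_tendsto_atTop
    (h.tendsto_iterReturnTime_atTop v) (x := s) (by simpa [iterReturnTime] using hs)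
  refine ⟨n + 1, le.antisymm' ?_⟩
  rw [iterReturnTime_succ, ← le_sub_iff_add_le']
  refine (h.isFirstReturnTime_returnTime (h.returnMap^[n] v)).2 ⟨sub_pos.2 lt, ?_⟩
  rwa [← h.flow_iterReturnTime, ← Φ.map_add, sub_add_cancel]

end IsCrossSection

theorem exists_forall_of_forall_existsUnique {ι Y : Type*} [Nonempty ι] [TopologicalSpace Y]
    {C : Set Y} (hC : IsPreconnected C) {P : ι → Y → Prop} (hP : ∀ i, IsOpen {y | P i y})
    (unique : ∀ y ∈ C, ∃! i, P i y) : ∃ i, ∀ y ∈ C, P i y := by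
  rcases C.eq_empty_or_nonempty with rfl | ⟨y₀, hy₀⟩
  · exact ⟨Classical.arbitrary ι, by simp⟩
  obtain ⟨i, hi, -⟩ := unique y₀ hy₀
  let V : Set Y := ⋃ j ∈ {j | j ≠ i}, {y | P j y}
  have cover : C ⊆ {y | P i y} ∪ V := fun y hy => by
    obtain ⟨j, hj, -⟩ := unique y hy
    rcases eq_or_ne j i with rfl | hji
    · exact .inl hj
    · exact .inr (mem_biUnion hji hj)
  have disjoint : C ∩ ({y | P i y} ∩ V) = ∅ := by
    rw [eq_empty_iff_forall_notMem]
    rintro y ⟨hy, hyi, hyV⟩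
    obtain ⟨j, hji, hyj⟩ := mem_iUnion₂.1 hyV
    exact hji ((unique y hy).unique hyj hyi)
  refine ⟨i, (isPreconnected_iff_subset_of_disjoint.1 hC _ _ (hP i)
    (isOpen_biUnion fun j _ => hP j) cover disjoint).resolve_right fun hV => ?_⟩
  exact notMem_empty y₀ (disjoint ▸ ⟨hy₀, hi, hV hy₀⟩)

namespace IsCrossSection

theorem exists_unique_hit_of_isCompact {X : Type*} [TopologicalSpace X] {Φ : Flow ℝ X} {A : Set X}
    (h : IsCrossSection Φ A) {C : Set X} (hC : IsCompact C) (hCA : C ⊆ A) :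
    ∃ ε > 0, ∀ v ∈ C, ∀ᶠ u in 𝓝 v, {s | |s| < ε ∧ Φ s u ∈ A}.Subsingleton := by
  have shrink {ε ε' : ℝ} (hε : ε' ≤ ε) {u : X} :
      {s | |s| < ε ∧ Φ s u ∈ A}.Subsingleton → {s | |s| < ε' ∧ Φ s u ∈ A}.Subsingleton :=
    fun unique => unique.anti fun _ hs => ⟨hs.1.trans_le hε, hs.2⟩
  refine hC.induction_on ⟨1, one_pos, by simp⟩
    (fun _ _ sub ⟨ε, hε, unique⟩ => ⟨ε, hε, fun v hv => unique v (sub hv)⟩) ?_ fun v hv => ?_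
  · rintro _ _ ⟨ε, hε, unique⟩ ⟨ε', hε', unique'⟩
    refine ⟨min ε ε', lt_min hε hε', fun v hv => hv.elim (fun hv => ?_) fun hv => ?_⟩
    · exact (unique v hv).mono fun _ => shrink (min_le_left _ _)
    · exact (unique' v hv).mono fun _ => shrink (min_le_right _ _)
  · obtain ⟨ε, hε, unique⟩ := h.unique_hit v (hCA hv)
    exact ⟨_, mem_nhdsWithin_of_mem_nhds (eventually_eventually_nhds.2 unique), ε, hε,
      fun _ => id⟩

theorem exists_existsUnique_hit_of_isCompact {X : Type*} [TopologicalSpace X] {Φ : Flow ℝ X}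
    {A : Set X} (h : IsCrossSection Φ A) {C : Set X} (hC : IsCompact C) (hCA : C ⊆ A) {R : ℝ}
    (hR : 0 < R) : ∃ ε > 0, ε ≤ R ∧ ∀ᶠ u in 𝓝ˢ C, ∃! s, |s| < ε ∧ Φ s u ∈ A := by
  obtain ⟨ε, hε, unique⟩ := h.exists_unique_hit_of_isCompact hC hCA
  have pos : 0 < min ε R := lt_min hε hR
  refine ⟨min ε R, pos, min_le_right _ _, eventually_nhdsSet_iff_forall.2 fun v hv => ?_⟩
  filter_upwards [unique v hv, h.hit v (hCA hv) _ pos] with u hu ⟨s, hs⟩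
  exact ⟨s, hs, fun s' hs' => hu ⟨hs'.1.trans_le (min_le_left _ _), hs'.2⟩
    ⟨hs.1.trans_le (min_le_left _ _), hs.2⟩⟩

theorem existsUnique_abs_iterReturnTime_sub_lt {X : Type*} [TopologicalSpace X] {Φ : Flow ℝ X}
    {A : Set X} (h : IsCrossSection Φ A) {v : A} {ε t : ℝ} (ht : ε ≤ t)
    (hit : ∃! s, |s| < ε ∧ Φ s (Φ t v) ∈ A) : ∃! n, |h.iterReturnTime n v - t| < ε := by
  obtain ⟨s, ⟨hs, hsA⟩, unique⟩ := hit
  rw [← Φ.map_add] at hsA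
  obtain ⟨n, hn⟩ := h.exists_iterReturnTime_eq v (by linarith [(abs_lt.1 hs).1]) hsA
  refine ⟨n, by simpa [hn] using hs, fun k hk => (h.strictMono_iterReturnTime v).injective ?_⟩
  have hit_k : Φ (h.iterReturnTime k v - t) (Φ t v) ∈ A := by
    rw [← Φ.map_add, sub_add_cancel, h.flow_iterReturnTime]
    exact (h.returnMap^[k] v).2
  exact hn ▸ sub_eq_iff_eq_add.1 (unique _ ⟨hk, hit_k⟩)

variable {X : Type*} [MetricSpace X] [CompactSpace X] {Φ : Flow ℝ X} {A : Set X}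

-- At a late time at which the flow is close to the identity, the orbit of each `v ∈ C` is about
-- to cross `A` or has just crossed it, exactly once; by connectedness it is the `n`-th crossing
-- with the same `n` for all `v ∈ C`.
theorem exists_iterate_returnMap_dist_lt (h : IsCrossSection Φ A)
    (hΦ : UniformEquicontinuous fun t => Φ t) {C : Set A} (hC : IsCompact C)
    (hC' : IsPreconnected C) {δ : ℝ} (hδ : 0 < δ) (m : ℕ) :
    ∃ n ≥ m, ∀ v ∈ C, dist (h.returnMap^[n] v : X) v < δ := by
  rcases C.eq_empty_or_nonempty with rfl | ⟨v₀, hv₀⟩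
  · exact ⟨m, le_rfl, by simp⟩
  have compact_image : IsCompact (Subtype.val '' C : Set X) := hC.image continuous_subtype_val
  obtain ⟨ρ, hρ, slow⟩ := exists_pos_forall_dist_flow_lt Φ (half_pos hδ)
  obtain ⟨ε, -, hερ, hit⟩ := h.exists_existsUnique_hit_of_isCompact compact_image
    (by simp) hρ
  obtain ⟨O, hO, hCO, hitO⟩ := eventually_nhdsSet_iff_exists.1 hit
  obtain ⟨η, hη, thick⟩ := compact_image.exists_thickening_subset_open hO hCO
  obtain ⟨t, ht, close⟩ := exists_gt_forall_dist_flow_lt hΦ (lt_min hη (half_pos hδ))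
    (|h.iterReturnTime m v₀| + ε)
  have unique (v : A) (hv : v ∈ C) : ∃! n, |h.iterReturnTime n v - t| < ε :=
    h.existsUnique_abs_iterReturnTime_sub_lt (by linarith [abs_nonneg (h.iterReturnTime m v₀)]) <|
      hitO _ <| thick <| Metric.mem_thickening_iff.2
        ⟨v, mem_image_of_mem _ hv, (close v).trans_le (min_le_left _ _)⟩
  have isOpen_time (n : ℕ) : IsOpen {v : A | |h.iterReturnTime n v - t| < ε} :=
    isOpen_lt ((h.continuous_iterReturnTime n).sub continuous_const).abs continuous_const
  obtain ⟨n, hn⟩ := exists_forall_of_forall_existsUnique hC' isOpen_time unique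
  refine ⟨n, ((h.strictMono_iterReturnTime v₀).lt_iff_lt.1 ?_).le, fun v hv => ?_⟩
  · linarith [(abs_lt.1 (hn v₀ hv₀)).1, le_abs_self (h.iterReturnTime m v₀)]
  · have near := slow (h.iterReturnTime n v - t) ((hn v hv).trans_le hερ) (Φ t v)
    rw [← Φ.map_add, sub_add_cancel, h.flow_iterReturnTime] at near
    linarith [dist_triangle (h.returnMap^[n] v : X) (Φ t v) v,
      (close v).trans_le (min_le_right _ _)]

end IsCrossSection

/-! ### Extension of a homeomorphism by the identity -/

theorem leftInverse_extend_id {A Y : Type*} {e : A → Y} (he : Function.Injective e)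
    {F G : A → A} (hFG : Function.LeftInverse G F) :
    Function.LeftInverse (Function.extend e (e ∘ G) id) (Function.extend e (e ∘ F) id) := by
  intro y
  by_cases hy : y ∈ range e
  · obtain ⟨a, rfl⟩ := hy
    simp [he.extend_apply, hFG a]
  · simp [Function.extend_apply' _ _ _ hy]

section Extension

variable {A Y : Type*} [TopologicalSpace A] [TopologicalSpace Y] {e : A → Y}

theorem continuous_extend_id (he : IsOpenEmbedding e) {F : A → A} (hF : Continuous F)
    (lim : ∀ y ∉ range e, Tendsto (e ∘ F) (comap e (𝓝 y)) (𝓝 y)) :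
    Continuous (Function.extend e (e ∘ F) id) := by
  refine continuous_iff_continuousAt.2 fun y => ?_
  by_cases hy : y ∈ range e
  · obtain ⟨a, rfl⟩ := hy
    rw [← he.continuousAt_iff, Function.extend_comp he.injective]
    exact (he.continuous.comp hF).continuousAt
  · rw [ContinuousAt, Function.extend_apply' _ _ _ hy]
    intro U (hU : U ∈ 𝓝 y)
    rw [mem_map]
    obtain ⟨V, hV, sub⟩ := mem_comap.1 (lim y hy hU)
    filter_upwards [hV, hU] with z hzV hzU
    by_cases hz : z ∈ range e
    · obtain ⟨a, rfl⟩ := hz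
      rw [mem_preimage, he.injective.extend_apply]
      exact sub hzV
    · rwa [mem_preimage, Function.extend_apply' _ _ _ hz]

/-- The extension by the identity of a homeomorphism of an open subspace which tends to the
identity at the points of the complement. -/
def extendHomeomorph (he : IsOpenEmbedding e) (F : A ≃ₜ A)
    (lim : ∀ y ∉ range e, Tendsto (e ∘ F) (comap e (𝓝 y)) (𝓝 y))
    (lim_symm : ∀ y ∉ range e, Tendsto (e ∘ F.symm) (comap e (𝓝 y)) (𝓝 y)) : Y ≃ₜ Y where
  toFun := Function.extend e (e ∘ F) id
  invFun := Function.extend e (e ∘ F.symm) id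
  left_inv := leftInverse_extend_id he.injective F.left_inv
  right_inv := leftInverse_extend_id he.injective F.right_inv
  continuous_toFun := continuous_extend_id he F.continuous lim
  continuous_invFun := continuous_extend_id he F.symm.continuous lim_symm

end Extension

/-! ### Recurrence of the extended return map -/

theorem isRecurrent_of_forall_exists {Y : Type*} [MetricSpace Y] {f : Y → Y} (hf : Continuous f)
    (close : ∀ ε > 0, ∀ m, ∃ n ≥ m, ∀ y, dist (f^[n] y) y < ε) : IsRecurrent f := by
  choose n hn close using fun k : ℕ => close (1 / ((k : ℝ) + 1)) (by positivity) k
  refine ⟨hf, n, tendsto_atTop_mono hn tendsto_id, ?_⟩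
  have lim : Tendsto (fun k : ℕ => ENNReal.ofReal (1 / ((k : ℝ) + 1))) atTop (𝓝 0) := by
    simpa using ENNReal.tendsto_ofReal (tendsto_one_div_add_atTop_nhds_zero_nat (𝕜 := ℝ))
  refine tendsto_of_tendsto_of_tendsto_of_le_of_le tendsto_const_nhds lim (fun _ => zero_le)
    fun k => iSup_le fun y => ?_
  rw [edist_dist]
  exact ENNReal.ofReal_le_ofReal (close k y).le

/-- Every compact part of `s` lies in a compact connected part of `s`. -/
def IsExhaustedByContinua {Y : Type*} [TopologicalSpace Y] (s : Set Y) : Prop :=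
  ∀ C ⊆ s, IsCompact C → ∃ K ⊆ s, IsCompact K ∧ IsPreconnected K ∧ C ⊆ K

/-- The compact set `B` is mapped onto `Y` by `p`, injectively over the complement of the closed
set `P` of poles, and `A` is the part of `B` lying over that complement. The fibres over the poles
are invariant under the flow. -/
structure IsPolarCollapse {X Y : Type*} [TopologicalSpace X] [TopologicalSpace Y] (Φ : Flow ℝ X)
    (A B : Set X) (p : X → Y) (P : Set Y) : Prop where
  isCompact : IsCompact B
  isClosed : IsClosed P
  continuousOn : ContinuousOn p B
  surjOn : SurjOn p B univ
  mem_iff : ∀ v, v ∈ A ↔ v ∈ B ∧ p v ∉ P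
  injOn : InjOn p A
  invariant : ∀ v ∈ B, p v ∈ P → ∀ t, Φ t v ∈ B ∧ p (Φ t v) = p v

namespace IsPolarCollapse

section Topological

variable {X Y : Type*} [TopologicalSpace X] [TopologicalSpace Y] {Φ : Flow ℝ X} {A B : Set X}
  {p : X → Y} {P : Set Y}

theorem subset (h : IsPolarCollapse Φ A B p P) : A ⊆ B := fun v hv => ((h.mem_iff v).1 hv).1

theorem mem_of_mem_closure [T2Space X] (h : IsPolarCollapse Φ A B p P) {v : X} (hv : v ∈ A)
    (t : ℝ) (ht : Φ t v ∈ closure A) : Φ t v ∈ A := by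
  have mem : Φ t v ∈ B := closure_minimal h.subset h.isCompact.isClosed ht
  refine (h.mem_iff _).2 ⟨mem, fun pole => ((h.mem_iff v).1 hv).2 ?_⟩
  have back := (h.invariant _ mem pole (-t)).2
  rw [← Φ.map_add, neg_add_cancel, Φ.map_zero_apply] at back
  rwa [back]

theorem range_eq (h : IsPolarCollapse Φ A B p P) : range (fun v : A => p v) = Pᶜ := by
  refine Subset.antisymm (range_subset_iff.2 fun v => ((h.mem_iff v).1 v.2).2) fun y hy => ?_
  obtain ⟨v, hv, rfl⟩ := h.surjOn (mem_univ y)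
  exact ⟨⟨v, (h.mem_iff v).2 ⟨hv, hy⟩⟩, rfl⟩

theorem reverse (h : IsPolarCollapse Φ A B p P) :
    IsPolarCollapse Φ.reverse A B p P :=
  { h with invariant := fun v hv pole t => h.invariant v hv pole (-t) }

variable [T2Space Y]

theorem eventually_forall_fiber (h : IsPolarCollapse Φ A B p P) {y : Y} {Q : X → Prop}
    (hQ : ∀ v ∈ B, p v = y → ∀ᶠ u in 𝓝 v, u ∈ B → Q u) :
    ∀ᶠ z in 𝓝 y, ∀ v ∈ B, p v = z → Q v := by
  have := isCompact_iff_compactSpace.1 h.isCompact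
  have closed : IsClosedMap (B.domRestrict p) := h.continuousOn.domRestrict.isClosedMap
  have near (v : B) (hv : v ∈ B.domRestrict p ⁻¹' {y}) : ∀ᶠ u : B in 𝓝 v, Q u :=
    (continuous_subtype_val.continuousAt.eventually (hQ v v.2 hv)).mono fun u hu => hu u.2
  filter_upwards [closed.eventually_nhds_fiber y near] with z hz v hv hvz
  exact hz ⟨v, hv⟩ hvz

theorem isOpenEmbedding (h : IsPolarCollapse Φ A B p P) :
    IsOpenEmbedding (fun v : A => p v) := by
  refine .of_continuous_injective_isOpenMap
    (continuousOn_iff_continuous_domRestrict.1 (h.continuousOn.mono h.subset))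
    (fun v w eq => Subtype.ext (h.injOn v.2 w.2 eq)) (isOpenMap_iff_nhds_le.2 fun v U hU => ?_)
  obtain ⟨O, hO, sub⟩ := mem_nhds_subtype _ _ _ |>.1 (mem_map.1 hU)
  have off_pole := ((h.mem_iff v).1 v.2).2
  have fiber_near : ∀ᶠ z in 𝓝 (p v), ∀ w ∈ B, p w = z → w ∈ O :=
    h.eventually_forall_fiber fun w hw eq => by
      have : w ∈ A := (h.mem_iff w).2 ⟨hw, eq ▸ off_pole⟩
      filter_upwards [h.injOn v.2 this eq.symm ▸ hO] with u hu _ using hu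
  filter_upwards [fiber_near, h.isClosed.isOpen_compl.mem_nhds off_pole] with z hz off
  obtain ⟨w, rfl⟩ := h.range_eq ▸ off
  exact sub (hz w (h.subset w.2) rfl)

end Topological

variable {X Y : Type*} [MetricSpace X] [CompactSpace X] {Φ : Flow ℝ X} {A B : Set X}
  {p : X → Y} {P : Set Y}

theorem eventually_flow_mem [TopologicalSpace Y] [T2Space Y] (h : IsPolarCollapse Φ A B p P)
    (hΦ : UniformEquicontinuous fun t => Φ t) {y : Y} (hy : y ∈ P) {U : Set Y} (hU : U ∈ 𝓝 y) :
    ∀ᶠ z in 𝓝 y, ∀ v ∈ B, p v = z → ∀ t, Φ t v ∈ B → p (Φ t v) ∈ U := by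
  have closed : IsClosed (B ∩ p ⁻¹' {y}) :=
    h.continuousOn.preimage_isClosed_of_isClosed h.isCompact.isClosed isClosed_singleton
  have near : ∀ᶠ v in 𝓝ˢ (B ∩ p ⁻¹' {y}), v ∈ B → p v ∈ U :=
    eventually_nhdsSet_iff_forall.2 fun v hv =>
      eventually_nhdsWithin_iff.1 (h.continuousOn v hv.1 ((hv.2 : p v = y) ▸ hU))
  obtain ⟨O, hO, sub, hOU⟩ := eventually_nhdsSet_iff_exists.1 near
  obtain ⟨ε, hε, thick⟩ := closed.isCompact.exists_thickening_subset_open hO sub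
  refine h.eventually_forall_fiber fun g hg hgy => ?_
  filter_upwards [hΦ.equicontinuous g _ (Metric.dist_mem_uniformity hε)] with v hv _ t
  obtain ⟨mem, eq⟩ := h.invariant g hg (hgy ▸ hy) t
  exact hOU _ (thick (Metric.mem_thickening_iff.2
    ⟨Φ t g, ⟨mem, eq.trans hgy⟩, dist_comm (Φ t g) _ ▸ hv t⟩))

theorem tendsto_returnMap [TopologicalSpace Y] [T2Space Y] (h : IsPolarCollapse Φ A B p P)
    (hΦ : UniformEquicontinuous fun t => Φ t) (hA : IsCrossSection Φ A) {y : Y} (hy : y ∈ P) :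
    Tendsto (fun v : A => p (hA.returnMap v)) (comap (fun v : A => p v) (𝓝 y)) (𝓝 y) := by
  intro U hU
  refine mem_comap.2 ⟨_, h.eventually_flow_mem hΦ hy hU, fun v hv => ?_⟩
  exact hv v (h.subset v.2) rfl _ (h.subset (hA.returnMap v).2)

/-- The extension of the return map over the poles, which it fixes. -/
def extendedReturnMap [TopologicalSpace Y] [T2Space Y] (h : IsPolarCollapse Φ A B p P)
    (hΦ : UniformEquicontinuous fun t => Φ t) (hA : IsCrossSection Φ A) : Y ≃ₜ Y :=
  extendHomeomorph h.isOpenEmbedding hA.returnHomeomorph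
    (fun y hy => h.tendsto_returnMap hΦ hA (by simpa [h.range_eq] using hy))
    fun y hy => h.reverse.tendsto_returnMap (hΦ.comp Neg.neg) hA.reverse
      (by simpa [h.range_eq] using hy)

theorem extendedReturnMap_apply [TopologicalSpace Y] [T2Space Y] (h : IsPolarCollapse Φ A B p P)
    (hΦ : UniformEquicontinuous fun t => Φ t) (hA : IsCrossSection Φ A) (v : A) :
    h.extendedReturnMap hΦ hA (p v) = p (hA.returnMap v) :=
  h.isOpenEmbedding.injective.extend_apply _ _ v

theorem extendedReturnMap_of_mem [TopologicalSpace Y] [T2Space Y] (h : IsPolarCollapse Φ A B p P)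
    (hΦ : UniformEquicontinuous fun t => Φ t) (hA : IsCrossSection Φ A) {y : Y} (hy : y ∈ P) :
    h.extendedReturnMap hΦ hA y = y :=
  Function.extend_apply' _ _ _ fun (mem : y ∈ range fun v : A => p v) =>
    h.range_eq.subset mem hy

theorem iterate_extendedReturnMap_apply [TopologicalSpace Y] [T2Space Y]
    (h : IsPolarCollapse Φ A B p P) (hΦ : UniformEquicontinuous fun t => Φ t)
    (hA : IsCrossSection Φ A) (n : ℕ) (v : A) :
    (h.extendedReturnMap hΦ hA)^[n] (p v) = p (hA.returnMap^[n] v) :=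
  (Function.Semiconj.iterate_right (f := fun v : A => p v)
    (fun v => (h.extendedReturnMap_apply hΦ hA v).symm) n v).symm

variable [MetricSpace Y]

theorem exists_iterate_extendedReturnMap_dist_lt (h : IsPolarCollapse Φ A B p P)
    (hΦ : UniformEquicontinuous fun t => Φ t) (hA : IsCrossSection Φ A)
    (hP : IsExhaustedByContinua Pᶜ) {ε : ℝ} (hε : 0 < ε) (m : ℕ) :
    ∃ n ≥ m, ∀ y, dist ((h.extendedReturnMap hΦ hA)^[n] y) y < ε := by
  let stable : Set Y := {z | ∀ v ∈ B, p v = z → ∀ t, Φ t v ∈ B → dist (p (Φ t v)) z < ε}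
  have stable_near : stable ∈ 𝓝ˢ P := by
    refine mem_nhdsSet_iff_forall.2 fun y hy => ?_
    have ball_mem := Metric.ball_mem_nhds y (half_pos hε)
    filter_upwards [h.eventually_flow_mem hΦ hy ball_mem, ball_mem] with z hz hzy v hv hvz t ht
    linarith [dist_triangle_right (p (Φ t v)) z y, Metric.mem_ball.1 hzy,
      Metric.mem_ball.1 (hz v hv hvz t ht)]
  have : CompactSpace Y := isCompact_univ_iff.1 <|
    univ_subset_iff.1 h.surjOn ▸ h.isCompact.image_of_continuousOn h.continuousOn
  obtain ⟨K, hKP, hK, hK', core⟩ := hP (interior stable)ᶜ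
    (compl_subset_compl.2 (subset_interior_iff_mem_nhdsSet.2 stable_near))
    isOpen_interior.isClosed_compl.isCompact
  have K_range : K ⊆ range fun v : A => p v := h.range_eq ▸ hKP
  obtain ⟨δ, hδ, unif⟩ := Metric.uniformContinuousOn_iff.1
    (h.isCompact.uniformContinuousOn_of_continuous h.continuousOn) ε hε
  obtain ⟨n, hn, close⟩ := hA.exists_iterate_returnMap_dist_lt hΦ
    ((h.isOpenEmbedding.isInducing.isCompact_preimage_iff K_range).2 hK)
    (hK'.preimage_of_isOpenMap h.isOpenEmbedding.injective h.isOpenEmbedding.isOpenMap K_range)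
    hδ m
  refine ⟨n, hn, fun y => ?_⟩
  by_cases hy : y ∈ P
  · rwa [Function.iterate_fixed (h.extendedReturnMap_of_mem hΦ hA hy), dist_self]
  obtain ⟨v, rfl⟩ : y ∈ range fun v : A => p v := h.range_eq ▸ hy
  rw [h.iterate_extendedReturnMap_apply]
  by_cases hv : p v ∈ stable
  · rw [← hA.flow_iterReturnTime]
    refine hv v (h.subset v.2) rfl _ ?_
    rw [hA.flow_iterReturnTime]
    exact h.subset (hA.returnMap^[n] v).2
  · exact unif _ (h.subset (hA.returnMap^[n] v).2) _ (h.subset v.2)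
      (close v (core fun mem => hv (interior_subset mem)))

theorem isRecurrent_extendedReturnMap (h : IsPolarCollapse Φ A B p P)
    (hΦ : UniformEquicontinuous fun t => Φ t) (hA : IsCrossSection Φ A)
    (hP : IsExhaustedByContinua Pᶜ) : IsRecurrent (h.extendedReturnMap hΦ hA) :=
  isRecurrent_of_forall_exists (h.extendedReturnMap hΦ hA).continuous fun _ hε m =>
    h.exists_iterate_extendedReturnMap_dist_lt hΦ hA hP hε m

end IsPolarCollapse

/-! ### Sphere bundles -/

section SphereBundle

variable {B F : Type*} [TopologicalSpace B] [NormedAddCommGroup F] [NormedSpace ℝ F]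
  {E : B → Type*} [TopologicalSpace (TotalSpace F E)] [∀ x, NormedAddCommGroup (E x)]
  [∀ x, InnerProductSpace ℝ (E x)] [FiberBundle F E] [VectorBundle ℝ F E]
  [IsContinuousRiemannianBundle F E]

theorem continuous_norm_totalSpace : Continuous fun v : TotalSpace F E => ‖v.2‖ := by
  have inner_self : Continuous fun v : TotalSpace F E => inner ℝ v.2 v.2 :=
    Continuous.inner_bundle (b := fun v : TotalSpace F E => v.1) (v := fun v => v.2)
      (w := fun v => v.2) continuous_id continuous_id
  simp_rw [norm_eq_sqrt_real_inner]
  exact inner_self.sqrt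

variable [ProperSpace F] [T2Space B]

theorem exists_mem_nhds_isCompact_setOf_norm_eq_one [LocallyCompactSpace B] (x : B) :
    ∃ K ∈ 𝓝 x, IsCompact {v : TotalSpace F E | v.1 ∈ K ∧ ‖v.2‖ = 1} := by
  obtain ⟨C, -, bound⟩ := eventually_norm_trivializationAt_lt F E x
  set e := trivializationAt F E x
  have base : e.baseSet ∈ 𝓝 x :=
    e.open_baseSet.mem_nhds (FiberBundle.mem_baseSet_trivializationAt' x)
  obtain ⟨K, hK, sub, compact⟩ := local_compact_nhds (inter_mem base bound)
  have box : IsCompact (e.toOpenPartialHomeomorph.symm '' (K ×ˢ Metric.closedBall (0 : F) C)) :=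
    (compact.prod (isCompact_closedBall _ _)).image_of_continuousOn <|
      e.toOpenPartialHomeomorph.continuousOn_symm.mono fun q hq => e.mem_target.2 (sub hq.1).1
  have closed : IsClosed {v : TotalSpace F E | v.1 ∈ K ∧ ‖v.2‖ = 1} :=
    (compact.isClosed.preimage (FiberBundle.continuous_proj F E)).inter
      (isClosed_eq continuous_norm_totalSpace continuous_const)
  refine ⟨K, hK, box.of_isClosed_subset closed fun v ⟨hv, norm_v⟩ => ⟨e v, ⟨?_, ?_⟩, ?_⟩⟩
  · rwa [e.coe_fst' (sub hv).1]
  · have le := (e.continuousLinearMapAt ℝ v.1).le_opNorm v.2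
    rw [Trivialization.continuousLinearMapAt_apply, Trivialization.linearMapAt_apply,
      if_pos (sub hv).1, norm_v, mul_one] at le
    exact mem_closedBall_zero_iff.2 (le.trans (sub hv).2.le)
  · exact e.toOpenPartialHomeomorph.left_inv (e.mem_source.2 (sub hv).1)

theorem isCompact_setOf_norm_eq_one [CompactSpace B] :
    IsCompact {v : TotalSpace F E | ‖v.2‖ = 1} := by
  choose K hK compact using exists_mem_nhds_isCompact_setOf_norm_eq_one (F := F) (E := E)
  obtain ⟨t, -, cover⟩ := isCompact_univ.elim_nhds_subcover K fun x _ => hK x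
  refine (t.isCompact_biUnion fun x _ => compact x).of_isClosed_subset
    (isClosed_eq continuous_norm_totalSpace continuous_const) fun v hv => ?_
  obtain ⟨x, hx, hvx⟩ := mem_iUnion₂.1 (cover (mem_univ v.1))
  exact mem_iUnion₂.2 ⟨x, hx, hvx, hv⟩

end SphereBundle

/-! ### The tangent bundle in charts -/

section TangentLift

variable {M : Type*} [TopologicalSpace M] [ChartedSpace Plane M]

/-- The lift of a curve to the tangent bundle by its velocity. -/
def tangentLift (σ : ℝ → M) (t : ℝ) : TangentBundle (𝓡 2) M := ⟨σ t, velocity σ t⟩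

variable [IsManifold (𝓡 2) ∞ M]

theorem continuous_tangentLift {σ : ℝ → M} (hσ : ContMDiff 𝓘(ℝ, ℝ) (𝓡 2) ∞ σ) :
    Continuous (tangentLift σ) := by
  have unit_field : Continuous fun t : ℝ => (⟨t, (1 : ℝ)⟩ : TangentBundle 𝓘(ℝ, ℝ) ℝ) :=
    (tangentBundleModelSpaceHomeomorph 𝓘(ℝ, ℝ)).symm.continuous.comp
      (Continuous.prodMk_left (1 : ℝ) (X := ℝ))
  exact (hσ.continuous_tangentMap (by simp)).comp unit_field

end TangentLift

/-- The coordinate vector of a tangent vector with respect to a chart. -/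
def coordVec {M : Type*} [TopologicalSpace M] [ChartedSpace Plane M]
    (e : OpenPartialHomeomorph M Plane) (v : TangentBundle (𝓡 2) M) : Plane :=
  mfderiv (𝓡 2) (𝓡 2) e v.1 v.2

section CoordVec

variable {M : Type*} [TopologicalSpace M] [ChartedSpace Plane M]
  {e : OpenPartialHomeomorph M Plane}

theorem continuousOn_coordVec [IsManifold (𝓡 2) ∞ M]
    (he : e ∈ IsManifold.maximalAtlas (𝓡 2) ∞ M) :
    ContinuousOn (coordVec e) {v | v.1 ∈ e.source} := by
  have tangent_map : ContinuousOn (tangentMapWithin (𝓡 2) (𝓡 2) e e.source) {v | v.1 ∈ e.source} :=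
    (contMDiffOn_of_mem_maximalAtlas he).continuousOn_tangentMapWithin (by simp)
      e.open_source.uniqueMDiffOn
  refine ((continuous_snd.comp
    (tangentBundleModelSpaceHomeomorph (𝓡 2)).continuous).comp_continuousOn tangent_map).congr
    fun v hv => ?_
  simp only [coordVec, Function.comp, tangentMapWithin]
  rw [mfderivWithin_of_isOpen e.open_source hv]
  rfl

theorem hasDerivAt_chart_comp (he : e ∈ IsManifold.maximalAtlas (𝓡 2) ∞ M) {σ : ℝ → M} {t : ℝ}
    (hσ : MDifferentiableAt 𝓘(ℝ, ℝ) (𝓡 2) σ t) (ht : σ t ∈ e.source) :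
    HasDerivAt (fun s => e (σ s)) (coordVec e (tangentLift σ t)) t := by
  have diff_e : MDifferentiableAt (𝓡 2) (𝓡 2) e (σ t) :=
    (contMDiffAt_of_mem_maximalAtlas he ht).mdifferentiableAt (by simp)
  have chain : HasFDerivAt (fun s => e (σ s)) (show ℝ →L[ℝ] Plane from
      (mfderiv (𝓡 2) (𝓡 2) e (σ t)).comp (mfderiv 𝓘(ℝ, ℝ) (𝓡 2) σ t)) t :=
    (diff_e.hasMFDerivAt.comp t hσ.hasMFDerivAt).hasFDerivAt
  exact chain.hasDerivAt

theorem mdifferentiable_of_mem_maximalAtlas (he : e ∈ IsManifold.maximalAtlas (𝓡 2) ∞ M) :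
    e.MDifferentiable (𝓡 2) (𝓡 2) :=
  ⟨(contMDiffOn_of_mem_maximalAtlas he).mdifferentiableOn (by simp),
    (contMDiffOn_symm_of_mem_maximalAtlas he).mdifferentiableOn (by simp)⟩

theorem eq_of_coordVec_eq (he : e ∈ IsManifold.maximalAtlas (𝓡 2) ∞ M)
    {v w : TangentBundle (𝓡 2) M} (hv : v.1 ∈ e.source) (base : v.1 = w.1)
    (coord : coordVec e v = coordVec e w) : v = w := by
  obtain ⟨x, v⟩ := v
  obtain ⟨y, w⟩ := w
  obtain rfl : x = y := base
  exact congrArg (TotalSpace.mk x)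
    ((mdifferentiable_of_mem_maximalAtlas he).mfderiv_injective hv coord)

theorem contMDiffOn_mfderiv_extChartAt_symm [IsManifold (𝓡 2) ∞ M] (p : M)
    {f : Plane × Plane × Plane → Plane} (hf : ContDiff ℝ ∞ f) :
    ContMDiffOn 𝓘(ℝ, Plane × Plane × Plane) ((𝓡 2).prod 𝓘(ℝ, Plane)) ∞
      (fun q : Plane × Plane × Plane => (⟨(extChartAt (𝓡 2) p).symm q.1,
        mfderiv (𝓡 2) (𝓡 2) (extChartAt (𝓡 2) p).symm q.1 (f q)⟩ : TangentBundle (𝓡 2) M))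
      ((extChartAt (𝓡 2) p).target ×ˢ univ) := by
  have base_and_vector : ContMDiffOn 𝓘(ℝ, Plane × Plane × Plane) ((𝓡 2).prod 𝓘(ℝ, Plane)) ∞
      (fun q : Plane × Plane × Plane => ((extChartAt (𝓡 2) p).symm q.1, f q))
      ((extChartAt (𝓡 2) p).target ×ˢ univ) :=
    ((contMDiffOn_extChartAt_symm p).comp contDiff_fst.contMDiff.contMDiffOn
      fun q hq => hq.1).prodMk hf.contMDiff.contMDiffOn
  have mem_source (q : Plane × Plane × Plane) (hq : q ∈ (extChartAt (𝓡 2) p).target ×ˢ univ) :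
      (extChartAt (𝓡 2) p).symm q.1 ∈ (chartAt Plane p).source := by
    rw [← extChartAt_source (𝓡 2)]
    exact (extChartAt (𝓡 2) p).map_target hq.1
  refine (((trivializationAt Plane (TangentSpace (𝓡 2) : M → Type _) p).contMDiffOn_symm
    (IB := 𝓡 2) (n := ∞)).comp base_and_vector fun q hq => ?_).congr fun q hq => ?_
  · rw [mem_preimage, Trivialization.mem_target]
    exact mem_source q hq
  · simp only [Function.comp]
    rw [← Trivialization.mk_symm _ (mem_source q hq), ← Trivialization.symmL_apply (R := ℝ),
      TangentBundle.symmL_trivializationAt (mem_source q hq),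
      (extChartAt (𝓡 2) p).right_inv hq.1, ModelWithCorners.range_eq_univ, mfderivWithin_univ]
    · rfl
    · exact mem_source q hq

end CoordVec

/-! ### The metric and the Christoffel symbols in charts -/

section ChartMetric

variable {M : Type*} [TopologicalSpace M] [ChartedSpace Plane M]
  [RiemannianBundle (fun x : M => TangentSpace (𝓡 2) x)]

theorem chartMetric_add_left (p : M) (y u u' w : Plane) :
    chartMetric p y (u + u') w = chartMetric p y u w + chartMetric p y u' w := by
  simp only [chartMetric]
  rw [← inner_add_left]
  exact congrArg (inner ℝ · _) (map_add (mfderiv (𝓡 2) (𝓡 2) (extChartAt (𝓡 2) p).symm y) u u')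

theorem chartMetric_smul_left (p : M) (y : Plane) (a : ℝ) (u w : Plane) :
    chartMetric p y (a • u) w = a * chartMetric p y u w := by
  simp only [chartMetric]
  rw [← real_inner_smul_left]
  exact congrArg (inner ℝ · _) (map_smul (mfderiv (𝓡 2) (𝓡 2) (extChartAt (𝓡 2) p).symm y) a u)

theorem chartMetric_comm (p : M) (y u w : Plane) :
    chartMetric p y u w = chartMetric p y w u := real_inner_comm _ _

theorem chartMetric_neg_left (p : M) (y u w : Plane) :
    chartMetric p y (-u) w = -chartMetric p y u w := by
  rw [← neg_one_smul ℝ, chartMetric_smul_left, neg_one_mul]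

theorem chartMetric_neg_right (p : M) (y u w : Plane) :
    chartMetric p y u (-w) = -chartMetric p y u w := by
  rw [chartMetric_comm, chartMetric_neg_left, chartMetric_comm]

theorem christoffel_neg (p : M) (y u w : Plane) :
    christoffel p y (-u) (-u) w = christoffel p y u u w := by
  simp [christoffel, chartMetric_neg_left, chartMetric_neg_right, fderiv_fun_neg]

variable [IsManifold (𝓡 2) ∞ M]

theorem chartMetric_self_pos {p : M} {y : Plane} (hy : y ∈ (extChartAt (𝓡 2) p).target) {u : Plane}
    (hu : u ≠ 0) : 0 < chartMetric p y u u := by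
  have : IsManifold (𝓡 2) 1 M := .of_le (n := ∞) (by simp)
  have inj : Function.Injective (mfderiv (𝓡 2) (𝓡 2) (extChartAt (𝓡 2) p).symm y) := by
    simpa using (isInvertible_mfderivWithin_extChartAt_symm hy).injective
  simp only [chartMetric, real_inner_self_eq_norm_sq]
  exact pow_pos (norm_pos_iff.2 fun eq_zero => hu <| inj <|
    eq_zero.trans (map_zero (mfderiv (𝓡 2) (𝓡 2) (extChartAt (𝓡 2) p).symm y)).symm) 2

variable [IsContMDiffRiemannianBundle (𝓡 2) ∞ Plane (fun x : M => TangentSpace (𝓡 2) x)]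

theorem contDiffOn_chartMetric (p : M) :
    ContDiffOn ℝ ∞ (fun q : Plane × Plane × Plane => chartMetric p q.1 q.2.1 q.2.2)
      ((extChartAt (𝓡 2) p).target ×ˢ univ) :=
  contMDiffOn_iff_contDiffOn.1 <|
    (contMDiffOn_mfderiv_extChartAt_symm p (f := fun q => q.2.1) (by fun_prop)).inner_bundle
      (contMDiffOn_mfderiv_extChartAt_symm p (f := fun q => q.2.2) (by fun_prop))

end ChartMetric

/-! ### Uniqueness of geodesics -/

/-- The coordinate vectors of the plane. -/
def planeBasis (i : Fin 2) : Plane := EuclideanSpace.single i 1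

theorem eq_smul_planeBasis_add_smul_planeBasis (u : Plane) :
    u = u 0 • planeBasis 0 + u 1 • planeBasis 1 := by
  ext i; fin_cases i <;> simp [planeBasis]

/-- The coordinates `(x, x')` of a tangent vector with respect to the chart at `p`. -/
def tangentCoord {M : Type*} [TopologicalSpace M] [ChartedSpace Plane M] (p : M)
    (v : TangentBundle (𝓡 2) M) : Plane × Plane :=
  (extChartAt (𝓡 2) p v.1, coordVec (chartAt Plane p) v)

section TangentCoord

variable {M : Type*} [TopologicalSpace M] [ChartedSpace Plane M] [IsManifold (𝓡 2) ∞ M]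

theorem isOpen_setOf_proj_mem_chart_source (p : M) :
    IsOpen {v : TangentBundle (𝓡 2) M | v.1 ∈ (chartAt Plane p).source} :=
  (chartAt Plane p).open_source.preimage (FiberBundle.continuous_proj Plane (TangentSpace (𝓡 2)))

theorem continuousOn_tangentCoord (p : M) :
    ContinuousOn (tangentCoord p) {v | v.1 ∈ (chartAt Plane p).source} :=
  ((continuousOn_extChartAt p).comp
      (FiberBundle.continuous_proj Plane (TangentSpace (𝓡 2))).continuousOn
      fun _ hv => by rwa [extChartAt_source]).prodMk
    (continuousOn_coordVec (IsManifold.chart_mem_maximalAtlas p))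

theorem injOn_tangentCoord (p : M) :
    InjOn (tangentCoord p) {v | v.1 ∈ (chartAt Plane p).source} := fun _ hv _ hw eq =>
  eq_of_coordVec_eq (IsManifold.chart_mem_maximalAtlas p) hv
    ((chartAt Plane p).injOn hv hw (congrArg Prod.fst eq)) (congrArg Prod.snd eq)

end TangentCoord

section GeodesicField

variable {M : Type*} [TopologicalSpace M] [ChartedSpace Plane M]
  [RiemannianBundle (fun x : M => TangentSpace (𝓡 2) x)]

/-- The Gram determinant of the coordinate vectors in the chart at `p`. -/
def gramDet (p : M) (y : Plane) : ℝ :=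
  chartMetric p y (planeBasis 0) (planeBasis 0) * chartMetric p y (planeBasis 1) (planeBasis 1)
    - chartMetric p y (planeBasis 0) (planeBasis 1) ^ 2

/-- The vector whose scalar products with the coordinate vectors are `b 0` and `b 1`, as given by
Cramer's rule. -/
def raiseIndex (p : M) (y : Plane) (b : Fin 2 → ℝ) : Plane :=
  ((b 0 * chartMetric p y (planeBasis 1) (planeBasis 1)
      - b 1 * chartMetric p y (planeBasis 0) (planeBasis 1)) / gramDet p y) • planeBasis 0 +
    ((b 1 * chartMetric p y (planeBasis 0) (planeBasis 0)
      - b 0 * chartMetric p y (planeBasis 0) (planeBasis 1)) / gramDet p y) • planeBasis 1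

/-- The vector field in the coordinates `(x, x')` whose integral curves are the geodesics. -/
def geodesicField (p : M) (q : Plane × Plane) : Plane × Plane :=
  (q.2, raiseIndex p q.1 fun i => -christoffel p q.1 q.2 q.2 (planeBasis i))

variable [IsManifold (𝓡 2) ∞ M]

theorem gramDet_pos {p : M} {y : Plane} (hy : y ∈ (extChartAt (𝓡 2) p).target) :
    0 < gramDet p y := by
  set g : Fin 2 → Fin 2 → ℝ := fun i j => chartMetric p y (planeBasis i) (planeBasis j)
  have g_pos : 0 < g 1 1 := chartMetric_self_pos hy (by simp [planeBasis])
  set v : Plane := g 1 1 • planeBasis 0 + (-g 0 1) • planeBasis 1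
  have v_ne_zero : v ≠ 0 := fun eq_zero => g_pos.ne' <| by
    simpa [v, planeBasis] using congrArg (fun u : Plane => u 0) eq_zero
  have scalar (i : Fin 2) : chartMetric p y v (planeBasis i) = g 1 1 * g 0 i - g 0 1 * g 1 i := by
    rw [chartMetric_add_left, chartMetric_smul_left, chartMetric_smul_left]
    ring
  have norm_sq : chartMetric p y v v = g 1 1 * gramDet p y := by
    conv_lhs => rw [chartMetric_add_left, chartMetric_smul_left, chartMetric_smul_left,
      chartMetric_comm p y _ v, chartMetric_comm p y _ v, scalar, scalar]
    rw [show g 1 0 = g 0 1 from chartMetric_comm p y _ _,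
      show gramDet p y = g 0 0 * g 1 1 - g 0 1 ^ 2 from rfl]
    ring
  exact pos_of_mul_pos_right (norm_sq ▸ chartMetric_self_pos hy v_ne_zero) g_pos.le

theorem eq_raiseIndex {p : M} {y : Plane} (hy : y ∈ (extChartAt (𝓡 2) p).target) {a : Plane}
    {b : Fin 2 → ℝ} (hab : ∀ i, chartMetric p y a (planeBasis i) = b i) :
    a = raiseIndex p y b := by
  have scalar (i : Fin 2) : a 0 * chartMetric p y (planeBasis 0) (planeBasis i)
      + a 1 * chartMetric p y (planeBasis 1) (planeBasis i) = b i := by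
    rw [← hab, ← chartMetric_smul_left, ← chartMetric_smul_left, ← chartMetric_add_left,
      ← eq_smul_planeBasis_add_smul_planeBasis]
  have scalar₀ := scalar 0
  rw [chartMetric_comm p y (planeBasis 1)] at scalar₀
  conv_lhs => rw [eq_smul_planeBasis_add_smul_planeBasis a]
  rw [raiseIndex]
  congr 2 <;> rw [eq_div_iff (gramDet_pos hy).ne', gramDet, ← scalar₀, ← scalar 1] <;> ring

theorem IsGeodesic.hasDerivAt_tangentCoord {σ : ℝ → M} (hσ : IsGeodesic σ) (p : M) {t : ℝ}
    (ht : σ t ∈ (chartAt Plane p).source) :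
    HasDerivAt (fun s => tangentCoord p (tangentLift σ s))
      (geodesicField p (tangentCoord p (tangentLift σ t))) t := by
  set c : ℝ → Plane := fun s => extChartAt (𝓡 2) p (σ s)
  have hasDerivAt_c {s : ℝ} (hs : σ s ∈ (chartAt Plane p).source) :
      HasDerivAt c (coordVec (chartAt Plane p) (tangentLift σ s)) s :=
    hasDerivAt_chart_comp (IsManifold.chart_mem_maximalAtlas p)
      ((hσ.smooth s).mdifferentiableAt (by simp)) hs
  have smooth_c : ContDiffAt ℝ ∞ c t := by
    have smooth_chart : ContMDiffAt (𝓡 2) 𝓘(ℝ, Plane) ∞ (extChartAt (𝓡 2) p) (σ t) :=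
      contMDiffAt_extChartAt' ht
    exact contMDiffAt_iff_contDiffAt.1 (smooth_chart.comp t (hσ.smooth t))
  have second_derivative : deriv (deriv c) t = raiseIndex p (c t) fun i =>
      -christoffel p (c t) (deriv c t) (deriv c t) (planeBasis i) :=
    eq_raiseIndex ((extChartAt (𝓡 2) p).map_source (by rwa [extChartAt_source])) fun i =>
      eq_neg_of_add_eq_zero_left (hσ.equation p t ht (planeBasis i))
  have deriv_c : deriv c =ᶠ[𝓝 t] fun s => coordVec (chartAt Plane p) (tangentLift σ s) := by
    filter_upwards [hσ.smooth.continuous.continuousAt.preimage_mem_nhds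
      ((chartAt Plane p).open_source.mem_nhds ht)] with s hs using (hasDerivAt_c hs).deriv
  have hasDerivAt_deriv : HasDerivAt (deriv c) (deriv (deriv c) t) t :=
    ((smooth_c.derivWithin (m := ∞) (by simp)).differentiableAt (by simp)).hasDerivAt
  rw [second_derivative, deriv_c.self_of_nhds] at hasDerivAt_deriv
  exact (hasDerivAt_c ht).prodMk (hasDerivAt_deriv.congr_of_eventuallyEq deriv_c.symm)

variable [IsContMDiffRiemannianBundle (𝓡 2) ∞ Plane (fun x : M => TangentSpace (𝓡 2) x)]

theorem contDiffAt_chartMetric_comp (p : M) {V : Type*} [NormedAddCommGroup V] [NormedSpace ℝ V]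
    {f : V → Plane × Plane × Plane} (hf : ContDiff ℝ ∞ f) {r : V}
    (hr : (f r).1 ∈ (extChartAt (𝓡 2) p).target) :
    ContDiffAt ℝ ∞ (fun r => chartMetric p (f r).1 (f r).2.1 (f r).2.2) r :=
  ((contDiffOn_chartMetric p).contDiffAt
    (((isOpen_extChartAt_target p).prod isOpen_univ).mem_nhds ⟨hr, mem_univ _⟩)).comp r
      hf.contDiffAt

theorem contDiffAt_christoffel {p : M} (w : Plane) {q : Plane × Plane}
    (hq : q.1 ∈ (extChartAt (𝓡 2) p).target) :
    ContDiffAt ℝ ∞ (fun q : Plane × Plane => christoffel p q.1 q.2 q.2 w) q := by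
  have metric_mixed : ContDiffAt ℝ ∞ (fun q : Plane × Plane =>
      fderiv ℝ (fun z => chartMetric p z q.2 w) q.1) q :=
    ContDiffAt.fderiv (n := ∞) (contDiffAt_chartMetric_comp p
      (f := fun r : (Plane × Plane) × Plane => (r.2, r.1.2, w)) (by fun_prop) hq)
      contDiffAt_fst (by simp)
  have metric_self : ContDiffAt ℝ ∞ (fun q : Plane × Plane =>
      fderiv ℝ (fun z => chartMetric p z q.2 q.2) q.1) q :=
    ContDiffAt.fderiv (n := ∞) (contDiffAt_chartMetric_comp p
      (f := fun r : (Plane × Plane) × Plane => (r.2, r.1.2, r.1.2)) (by fun_prop) hq)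
      contDiffAt_fst (by simp)
  simp only [christoffel]
  exact (((metric_mixed.clm_apply contDiffAt_snd).add (metric_mixed.clm_apply contDiffAt_snd)).sub
    (metric_self.clm_apply contDiffAt_const)).div_const 2

theorem contDiffAt_geodesicField {p : M} {q : Plane × Plane}
    (hq : q.1 ∈ (extChartAt (𝓡 2) p).target) : ContDiffAt ℝ ∞ (geodesicField p) q := by
  have metric (i j : Fin 2) : ContDiffAt ℝ ∞ (fun r : Plane × Plane =>
      chartMetric p r.1 (planeBasis i) (planeBasis j)) q :=
    contDiffAt_chartMetric_comp p (f := fun r : Plane × Plane => (r.1, planeBasis i, planeBasis j))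
      (by fun_prop) hq
  have det : ContDiffAt ℝ ∞ (fun r : Plane × Plane => gramDet p r.1) q :=
    ((metric 0 0).mul (metric 1 1)).sub ((metric 0 1).pow 2)
  have covector (i : Fin 2) : ContDiffAt ℝ ∞ (fun r : Plane × Plane =>
      -christoffel p r.1 r.2 r.2 (planeBasis i)) q := (contDiffAt_christoffel _ hq).neg
  have coefficient (i j : Fin 2) : ContDiffAt ℝ ∞ (fun r : Plane × Plane =>
      (-christoffel p r.1 r.2 r.2 (planeBasis i) * chartMetric p r.1 (planeBasis j) (planeBasis j)
        - -christoffel p r.1 r.2 r.2 (planeBasis j) *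
          chartMetric p r.1 (planeBasis 0) (planeBasis 1)) / gramDet p r.1) q :=
    (((covector i).mul (metric j j)).sub ((covector j).mul (metric 0 1))).div det
      (gramDet_pos hq).ne'
  exact contDiffAt_snd.prodMk
    (((coefficient 0 1).smul contDiffAt_const).add ((coefficient 1 0).smul contDiffAt_const))

theorem IsGeodesic.eventuallyEq {σ τ : ℝ → M} (hσ : IsGeodesic σ) (hτ : IsGeodesic τ) {t : ℝ}
    (eq : tangentLift σ t = tangentLift τ t) : tangentLift σ =ᶠ[𝓝 t] tangentLift τ := by
  set p := σ t
  obtain ⟨K, U, hU, lipschitz⟩ :=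
    ((contDiffAt_geodesicField (p := p) (q := tangentCoord p (tangentLift σ t))
      (mem_extChartAt_target p)).of_le (m := 1) (mod_cast le_top)).exists_lipschitzOnWith
  have eventually_mem_source {τ : ℝ → M} (hτ : IsGeodesic τ)
      (eq : tangentLift σ t = tangentLift τ t) :
      ∀ᶠ s in 𝓝 t, (tangentLift τ s).1 ∈ (chartAt Plane p).source :=
    (continuous_tangentLift hτ.smooth).continuousAt.preimage_mem_nhds <|
      (isOpen_setOf_proj_mem_chart_source p).mem_nhds (eq ▸ mem_chart_source Plane p)
  have eventually_solution {τ : ℝ → M} (hτ : IsGeodesic τ)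
      (eq : tangentLift σ t = tangentLift τ t) :
      ∀ᶠ s in 𝓝 t, HasDerivAt (fun r => tangentCoord p (tangentLift τ r))
        (geodesicField p (tangentCoord p (tangentLift τ s))) s ∧
        tangentCoord p (tangentLift τ s) ∈ U := by
    have mem_source := eventually_mem_source hτ eq
    filter_upwards [mem_source, (hτ.hasDerivAt_tangentCoord p
      mem_source.self_of_nhds).continuousAt.preimage_mem_nhds (eq ▸ hU)] with s hs mem_U
    exact ⟨hτ.hasDerivAt_tangentCoord p hs, mem_U⟩
  filter_upwards [ODE_solution_unique_of_eventually (v := fun _ => geodesicField p)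
      (s := fun _ => U) (.of_forall fun _ => lipschitz) (eventually_solution hσ rfl)
      (eventually_solution hτ eq) (congrArg (tangentCoord p) eq),
    eventually_mem_source hσ rfl, eventually_mem_source hτ eq] with s coord_eq hσs hτs
  exact injOn_tangentCoord p hσs hτs coord_eq

theorem IsGeodesic.tangentLift_eq [T2Space M] {σ τ : ℝ → M} (hσ : IsGeodesic σ)
    (hτ : IsGeodesic τ) {t : ℝ} (eq : tangentLift σ t = tangentLift τ t) :
    tangentLift σ = tangentLift τ := by
  have isOpen : IsOpen {t | tangentLift σ t = tangentLift τ t} :=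
    isOpen_iff_mem_nhds.2 fun s hs => hσ.eventuallyEq hτ hs
  have isClosed : IsClosed {t | tangentLift σ t = tangentLift τ t} := by
    refine isClosed_iff_frequently.2 fun s frequently_eq => ?_
    have base_eq : σ s = τ s := isClosed_iff_frequently.1
      (isClosed_eq hσ.smooth.continuous hτ.smooth.continuous) s
      (frequently_eq.mono fun r hr => congrArg TotalSpace.proj hr)
    have mem_σ : (tangentLift σ s).1 ∈ (chartAt Plane (σ s)).source := mem_chart_source Plane _
    have mem_τ : (tangentLift τ s).1 ∈ (chartAt Plane (σ s)).source := by
      simpa only [tangentLift, ← base_eq] using mem_σ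
    have continuousAt_coord {τ : ℝ → M} (hτ : IsGeodesic τ)
        (mem : (tangentLift τ s).1 ∈ (chartAt Plane (σ s)).source) :
        ContinuousAt (tangentCoord (σ s) ∘ tangentLift τ) s :=
      ((continuousOn_tangentCoord (σ s)).continuousAt
        ((isOpen_setOf_proj_mem_chart_source _).mem_nhds mem)).comp
        (continuous_tangentLift hτ.smooth).continuousAt
    exact injOn_tangentCoord (σ s) mem_σ mem_τ <|
      tendsto_nhds_unique_of_frequently_eq (continuousAt_coord hσ mem_σ)
        (continuousAt_coord hτ mem_τ) (frequently_eq.mono fun r hr => congrArg _ hr)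
  exact funext fun s => (IsClopen.eq_univ ⟨isClosed, isOpen⟩ ⟨t, eq⟩).ge (mem_univ s)

end GeodesicField

section Reversal

variable {M : Type*} [TopologicalSpace M] [ChartedSpace Plane M]

theorem tangentLift_comp_neg {σ : ℝ → M} {t : ℝ}
    (hσ : MDifferentiableAt 𝓘(ℝ, ℝ) (𝓡 2) σ (-t)) :
    tangentLift (fun s => σ (-s)) t = ⟨σ (-t), -velocity σ (-t)⟩ := by
  have neg : HasMFDerivAt 𝓘(ℝ, ℝ) 𝓘(ℝ, ℝ) (fun s : ℝ => -s) t
      (-ContinuousLinearMap.id ℝ ℝ : ℝ →L[ℝ] ℝ) := (hasFDerivAt_id t).neg.hasMFDerivAt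
  have chain := (HasMFDerivAt.comp t hσ.hasMFDerivAt neg).mfderiv
  refine congrArg (TotalSpace.mk (σ (-t))) ?_
  calc mfderiv 𝓘(ℝ, ℝ) (𝓡 2) (σ ∘ fun s => -s) t (1 : ℝ)
      = mfderiv 𝓘(ℝ, ℝ) (𝓡 2) σ (-t) (-(1 : ℝ)) := by rw [chain]; rfl
    _ = -velocity σ (-t) := map_neg (mfderiv 𝓘(ℝ, ℝ) (𝓡 2) σ (-t)) (1 : ℝ)

variable [IsManifold (𝓡 2) ∞ M] [RiemannianBundle (fun x : M => TangentSpace (𝓡 2) x)]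

theorem IsGeodesic.comp_neg {σ : ℝ → M} (hσ : IsGeodesic σ) : IsGeodesic (fun t => σ (-t)) where
  smooth := hσ.smooth.comp contDiff_neg.contMDiff
  unit_speed t := by
    have velocity_eq := tangentLift_comp_neg ((hσ.smooth (-t)).mdifferentiableAt (by simp))
    calc ‖(tangentLift (fun s => σ (-s)) t).2‖ = ‖-velocity σ (-t)‖ := by rw [velocity_eq]
      _ = 1 := by rw [norm_neg, hσ.unit_speed]
  equation p t ht := by
    intro c w
    set d : ℝ → Plane := fun s => extChartAt (𝓡 2) p (σ s)
    have deriv_c : deriv c = fun s => -deriv d (-s) := funext fun s => deriv_comp_neg d s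
    have deriv_deriv_c : deriv (deriv c) t = deriv (deriv d) (-t) := by
      rw [deriv_c, deriv.fun_neg, deriv_comp_neg (deriv d), neg_neg]
    rw [deriv_deriv_c, deriv_c, christoffel_neg]
    exact hσ.equation p (-t) ht w

end Reversal

/-! ### Oriented planes -/

/-- The oriented area spanned by two plane vectors. -/
def cross (a b : Plane) : ℝ := a 0 * b 1 - a 1 * b 0

/-- The rotation by a right angle, which turns oriented areas into scalar products. -/
def quarterTurn (a : Plane) : Plane := !₂[-a 1, a 0]

theorem inner_quarterTurn (a b : Plane) : inner ℝ (quarterTurn a) b = cross a b := by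
  simp only [PiLp.inner_apply, Fin.sum_univ_two, quarterTurn, cross, RCLike.inner_apply,
    Matrix.cons_val, conj_trivial]
  ring

theorem cross_quarterTurn (a : Plane) : cross a (quarterTurn a) = ‖a‖ ^ 2 := by
  simp only [EuclideanSpace.norm_sq_eq, Fin.sum_univ_two, Real.norm_eq_abs, sq_abs, quarterTurn,
    cross, Matrix.cons_val]
  ring

theorem cross_self (a : Plane) : cross a a = 0 := by rw [cross]; ring

theorem cross_add_right (a b c : Plane) : cross a (b + c) = cross a b + cross a c := by
  simp only [← inner_quarterTurn, inner_add_right]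

theorem cross_smul_right (a : Plane) (r : ℝ) (b : Plane) : cross a (r • b) = r * cross a b := by
  simp only [← inner_quarterTurn, real_inner_smul_right]

theorem cross_map (L : Plane →L[ℝ] Plane) (a b : Plane) :
    cross (L a) (L b) = L.det * cross a b := by
  have det_eq : L.det = cross (L (planeBasis 0)) (L (planeBasis 1)) := by
    rw [ContinuousLinearMap.det,
      ← LinearMap.det_toMatrix (EuclideanSpace.basisFun (Fin 2) ℝ).toBasis, Matrix.det_fin_two]
    simp only [LinearMap.toMatrix_apply, OrthonormalBasis.coe_toBasis_repr_apply,
      OrthonormalBasis.coe_toBasis, EuclideanSpace.basisFun_repr, EuclideanSpace.basisFun_apply,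
      cross, planeBasis, ContinuousLinearMap.coe_coe]
    ring
  have map_eq (c : Plane) : L c = c 0 • L (planeBasis 0) + c 1 • L (planeBasis 1) := by
    rw [← map_smul, ← map_smul, ← map_add, ← eq_smul_planeBasis_add_smul_planeBasis]
  rw [det_eq, map_eq a, map_eq b]
  simp only [cross, PiLp.add_apply, PiLp.smul_apply, smul_eq_mul]
  ring

theorem eq_smul_add_smul_of_cross_ne_zero {a b : Plane} (area : cross a b ≠ 0) (d : Plane) :
    d = (cross d b / cross a b) • a + (cross a d / cross a b) • b := by
  ext i
  simp only [PiLp.add_apply, PiLp.smul_apply, smul_eq_mul]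
  field_simp
  fin_cases i <;> simp only [cross, Fin.zero_eta, Fin.mk_one] <;> ring

theorem eq_of_inner_eq_of_cross_eq {a x y : Plane} (ha : a ≠ 0)
    (inner_eq : inner ℝ a x = inner ℝ a y) (cross_eq : cross a x = cross a y) : x = y := by
  have area : cross a (quarterTurn a) ≠ 0 := by
    rw [cross_quarterTurn]
    exact pow_ne_zero 2 (norm_ne_zero_iff.2 ha)
  have cross_quarterTurn_right (z : Plane) : cross z (quarterTurn a) = inner ℝ a z := by
    simp only [PiLp.inner_apply, Fin.sum_univ_two, quarterTurn, cross, RCLike.inner_apply,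
      Matrix.cons_val, conj_trivial]
    ring
  rw [eq_smul_add_smul_of_cross_ne_zero area x, eq_smul_add_smul_of_cross_ne_zero area y]
  simp only [cross_quarterTurn_right, inner_eq, cross_eq]

/-- An orthonormal pair in a Euclidean plane `V` which is positively oriented with respect to the
linear coordinates `L`. -/
structure IsOrientedFrame {V : Type*} [NormedAddCommGroup V] [InnerProductSpace ℝ V]
    (L : V →ₗ[ℝ] Plane) (u n : V) : Prop where
  norm_left : ‖u‖ = 1
  norm_right : ‖n‖ = 1
  orthogonal : inner ℝ u n = 0
  cross_pos : 0 < cross (L u) (L n)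

section OrientedFrame

variable {V : Type*} [NormedAddCommGroup V] [InnerProductSpace ℝ V] {L : V →ₗ[ℝ] Plane}
  {u n w w' : V}

theorem exists_isOrientedFrame (hL : Function.Bijective L) (hu : ‖u‖ = 1) :
    ∃ n, IsOrientedFrame L u n := by
  have u_ne_zero : u ≠ 0 := norm_ne_zero_iff.1 (hu ▸ one_ne_zero)
  have Lu_ne_zero : L u ≠ 0 := (map_ne_zero_iff L hL.1).2 u_ne_zero
  obtain ⟨m, hm⟩ := hL.2 (quarterTurn (L u))
  set n := m - (inner ℝ u m : ℝ) • u
  have orthogonal : inner ℝ u n = 0 := by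
    rw [inner_sub_right, real_inner_smul_right, real_inner_self_eq_norm_sq, hu]
    ring
  have cross_pos : 0 < cross (L u) (L n) := by
    rw [show n = m + (-inner ℝ u m : ℝ) • u by simp only [n]; module, map_add, map_smul, hm,
      cross_add_right, cross_smul_right, cross_self, cross_quarterTurn, mul_zero,
      add_zero]
    exact pow_pos (norm_pos_iff.2 Lu_ne_zero) 2
  have n_ne_zero : n ≠ 0 := fun eq_zero => by
    rw [eq_zero, ← zero_smul ℝ u, map_smul, cross_smul_right] at cross_pos
    simp at cross_pos
  refine ⟨‖n‖⁻¹ • n, hu, norm_smul_inv_norm n_ne_zero, ?_, ?_⟩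
  · rw [real_inner_smul_right, orthogonal, mul_zero]
  · rw [map_smul, cross_smul_right]
    have := norm_pos_iff.2 n_ne_zero
    positivity

namespace IsOrientedFrame

theorem eq_inner_smul_add_inner_smul (h : IsOrientedFrame L u n) (hL : Function.Injective L)
    (w : V) : w = (inner ℝ u w : ℝ) • u + (inner ℝ n w : ℝ) • n := by
  obtain ⟨x, y, rfl⟩ : ∃ x y : ℝ, w = x • u + y • n := by
    refine ⟨cross (L w) (L n) / cross (L u) (L n), cross (L u) (L w) / cross (L u) (L n), hL ?_⟩
    rw [map_add, map_smul, map_smul]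
    exact eq_smul_add_smul_of_cross_ne_zero h.cross_pos.ne' (L w)
  simp only [inner_add_right, real_inner_smul_right, real_inner_self_eq_norm_sq, h.norm_left,
    h.norm_right, h.orthogonal, real_inner_comm u n]
  module

theorem cross_map_eq (h : IsOrientedFrame L u n) (hL : Function.Injective L) (w : V) :
    cross (L u) (L w) = inner ℝ n w * cross (L u) (L n) := by
  conv_lhs => rw [h.eq_inner_smul_add_inner_smul hL w]
  rw [map_add, map_smul, map_smul, cross_add_right, cross_smul_right, cross_smul_right, cross_self]
  ring

theorem norm_smul_add_smul_sq (h : IsOrientedFrame L u n) (x y : ℝ) :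
    ‖x • u + y • n‖ ^ 2 = x ^ 2 + y ^ 2 := by
  rw [norm_add_sq_real, real_inner_smul_left, real_inner_smul_right, h.orthogonal, norm_smul,
    norm_smul, h.norm_left, h.norm_right]
  simp

theorem inner_sq_add_inner_sq (h : IsOrientedFrame L u n) (hL : Function.Injective L) (w : V) :
    inner ℝ u w ^ 2 + inner ℝ n w ^ 2 = ‖w‖ ^ 2 := by
  rw [← h.norm_smul_add_smul_sq, ← h.eq_inner_smul_add_inner_smul hL w]

end IsOrientedFrame

theorem eq_or_eq_neg_of_cross_eq_zero (hL : Function.Bijective L) (hu : ‖u‖ = 1) (hw : ‖w‖ = 1)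
    (area : cross (L u) (L w) = 0) : w = u ∨ w = -u := by
  obtain ⟨n, frame⟩ := exists_isOrientedFrame hL hu
  have normal_part : inner ℝ n w = 0 := by
    rw [frame.cross_map_eq hL.1] at area
    exact (mul_eq_zero.1 area).resolve_right frame.cross_pos.ne'
  have tangential_part := frame.inner_sq_add_inner_sq hL.1 w
  have w_eq := frame.eq_inner_smul_add_inner_smul hL.1 w
  rw [normal_part, zero_smul, add_zero] at w_eq
  rw [normal_part, hw, zero_pow two_ne_zero, add_zero, sq_eq_sq_iff_eq_or_eq_neg] at tangential_part
  exact tangential_part.imp (fun eq_one => by rw [w_eq, eq_one, one_smul])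
    fun eq_neg_one => by rw [w_eq, eq_neg_one, neg_one_smul]

theorem eq_of_inner_eq_of_cross_pos (hL : Function.Bijective L) (hu : ‖u‖ = 1)
    (norm_eq : ‖w‖ = ‖w'‖) (inner_eq : inner ℝ u w = inner ℝ u w') (area : 0 < cross (L u) (L w))
    (area' : 0 < cross (L u) (L w')) : w = w' := by
  obtain ⟨n, frame⟩ := exists_isOrientedFrame hL hu
  have normal_pos {w : V} (area : 0 < cross (L u) (L w)) : 0 < inner ℝ n w := by
    rw [frame.cross_map_eq hL.1] at area
    exact pos_of_mul_pos_left area frame.cross_pos.le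
  have normal_sq_eq : inner ℝ n w ^ 2 = inner ℝ n w' ^ 2 := by
    linear_combination frame.inner_sq_add_inner_sq hL.1 w - frame.inner_sq_add_inner_sq hL.1 w' +
      (‖w‖ + ‖w'‖) * norm_eq - (inner ℝ u w + inner ℝ u w') * inner_eq
  have normal_eq : inner ℝ n w = inner ℝ n w' :=
    (sq_eq_sq₀ (normal_pos area).le (normal_pos area').le).1 normal_sq_eq
  rw [frame.eq_inner_smul_add_inner_smul hL.1 w, frame.eq_inner_smul_add_inner_smul hL.1 w',
    inner_eq, normal_eq]

theorem exists_angle_eq_and_cross_pos (hL : Function.Bijective L) (hu : ‖u‖ = 1) {α : ℝ}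
    (hα : α ∈ Ioo 0 Real.pi) :
    ∃ w : V, ‖w‖ = 1 ∧ InnerProductGeometry.angle u w = α ∧ 0 < cross (L u) (L w) := by
  obtain ⟨n, frame⟩ := exists_isOrientedFrame hL hu
  have norm_eq : ‖Real.cos α • u + Real.sin α • n‖ = 1 := by
    rw [← pow_eq_one_iff_of_nonneg (norm_nonneg _) two_ne_zero, frame.norm_smul_add_smul_sq,
      Real.cos_sq_add_sin_sq]
  refine ⟨Real.cos α • u + Real.sin α • n, norm_eq, ?_, ?_⟩
  · rw [InnerProductGeometry.angle, norm_eq, hu, inner_add_right, real_inner_smul_right,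
      real_inner_smul_right, frame.orthogonal, real_inner_self_eq_norm_sq, hu]
    simpa using Real.arccos_cos hα.1.le hα.2.le
  · rw [map_add, map_smul, map_smul, cross_add_right, cross_smul_right, cross_smul_right,
      cross_self, mul_zero, zero_add]
    exact mul_pos (Real.sin_pos_of_mem_Ioo hα) frame.cross_pos

theorem angle_mem_Ioo_of_cross_ne_zero (area : cross (L u) (L w) ≠ 0) :
    InnerProductGeometry.angle u w ∈ Ioo 0 Real.pi := by
  have not_smul (r : ℝ) : w ≠ r • u := by
    rintro rfl
    exact area (by rw [map_smul, cross_smul_right, cross_self, mul_zero])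
  refine ⟨(InnerProductGeometry.angle_nonneg u w).lt_of_ne fun eq_zero => ?_,
    (InnerProductGeometry.angle_le_pi u w).lt_of_ne fun eq_pi => ?_⟩
  · obtain ⟨-, r, -, hr⟩ := InnerProductGeometry.angle_eq_zero_iff.1 eq_zero.symm
    exact not_smul r hr
  · obtain ⟨-, r, -, hr⟩ := InnerProductGeometry.angle_eq_pi_iff.1 eq_pi
    exact not_smul r hr

end OrientedFrame

/-! ### Polar coordinates on the sphere -/

theorem spherePoint_eq_iff {α β α' β' : ℝ} : spherePoint α β = spherePoint α' β' ↔
    Real.sin α * Real.cos β = Real.sin α' * Real.cos β' ∧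
    Real.sin α * Real.sin β = Real.sin α' * Real.sin β' ∧ Real.cos α = Real.cos α' := by
  simp only [Subtype.ext_iff, spherePoint, WithLp.toLp.injEq, funext_iff, Fin.forall_fin_succ,
    Matrix.cons_val]
  simp

theorem spherePoint_eq_northPole_iff {α β : ℝ} (hα : α ∈ Icc 0 Real.pi) :
    spherePoint α β = northPole ↔ α = 0 := by
  rw [northPole, spherePoint_eq_iff]
  refine ⟨fun eq => Real.injOn_cos hα ⟨le_rfl, Real.pi_pos.le⟩ eq.2.2, ?_⟩
  rintro rfl
  simp

theorem spherePoint_eq_southPole_iff {α β : ℝ} (hα : α ∈ Icc 0 Real.pi) :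
    spherePoint α β = southPole ↔ α = Real.pi := by
  rw [southPole, spherePoint_eq_iff]
  refine ⟨fun eq => Real.injOn_cos hα ⟨Real.pi_pos.le, le_rfl⟩ eq.2.2, ?_⟩
  rintro rfl
  simp

theorem spherePoint_notMem_poles_iff {α β : ℝ} (hα : α ∈ Icc 0 Real.pi) :
    spherePoint α β ∉ ({northPole, southPole} : Set S2) ↔ α ∈ Ioo 0 Real.pi := by
  rw [mem_insert_iff, mem_singleton_iff, spherePoint_eq_northPole_iff hα,
    spherePoint_eq_southPole_iff hα, not_or, mem_Ioo, hα.1.lt_iff_ne', hα.2.lt_iff_ne]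

theorem spherePoint_inj {α β α' β' : ℝ} (hα : α ∈ Ioo 0 Real.pi) (hα' : α' ∈ Ioo 0 Real.pi)
    (eq : spherePoint α β = spherePoint α' β') :
    α = α' ∧ ∃ k : ℤ, β' = β + k * (2 * Real.pi) := by
  rw [spherePoint_eq_iff] at eq
  obtain rfl : α = α' :=
    Real.injOn_cos (Ioo_subset_Icc_self hα) (Ioo_subset_Icc_self hα') eq.2.2
  have sin_ne_zero := (Real.sin_pos_of_mem_Ioo hα).ne'
  obtain ⟨k, hk⟩ := Real.Angle.angle_eq_iff_two_pi_dvd_sub.1 <| Real.Angle.cos_sin_inj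
    (mul_left_cancel₀ sin_ne_zero eq.1).symm (mul_left_cancel₀ sin_ne_zero eq.2.1).symm
  exact ⟨rfl, k, by linear_combination hk⟩

theorem continuousWithinAt_spherePoint {X : Type*} [TopologicalSpace X] {α β : X → ℝ} {s : Set X}
    {x : X} (hα : ContinuousWithinAt α s x)
    (hcos : ContinuousWithinAt (fun x => Real.cos (β x)) s x)
    (hsin : ContinuousWithinAt (fun x => Real.sin (β x)) s x) :
    ContinuousWithinAt (fun x => spherePoint (α x) (β x)) s x := by
  have hsin_α := Real.continuous_sin.continuousAt.comp_continuousWithinAt hα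
  have hcos_α := Real.continuous_cos.continuousAt.comp_continuousWithinAt hα
  refine tendsto_subtype_rng.2 (((PiLp.continuous_toLp 2 _).tendsto _).comp
    (tendsto_pi_nhds.2 fun i => ?_))
  fin_cases i
  exacts [hsin_α.mul hcos, hsin_α.mul hsin, hcos_α]

theorem continuous_spherePoint : Continuous fun q : ℝ × ℝ => spherePoint q.1 q.2 := by
  refine continuous_iff_continuousAt.2 fun q => (continuousWithinAt_univ _ _).1 ?_
  exact continuousWithinAt_spherePoint continuous_fst.continuousWithinAt
    (Real.continuous_cos.comp continuous_snd).continuousWithinAt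
    (Real.continuous_sin.comp continuous_snd).continuousWithinAt

theorem exists_spherePoint_eq (y : S2) :
    ∃ α ∈ Icc 0 Real.pi, ∃ β ∈ Icc (-Real.pi) Real.pi, spherePoint α β = y := by
  have norm_sq : y.1 0 ^ 2 + y.1 1 ^ 2 + y.1 2 ^ 2 = 1 := by
    simpa [Fin.sum_univ_three, mem_sphere_zero_iff_norm.1 y.2] using
      (EuclideanSpace.norm_sq_eq y.1).symm
  have abs_le : |y.1 2| ≤ 1 :=
    abs_le_one_iff_mul_self_le_one.2 (by nlinarith [sq_nonneg (y.1 0), sq_nonneg (y.1 1)])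
  set z : ℂ := ⟨y.1 0, y.1 1⟩
  have norm_z : ‖z‖ = Real.sin (Real.arccos (y.1 2)) := by
    rw [Real.sin_arccos, Complex.norm_eq_sqrt_sq_add_sq]
    congr 1
    linear_combination norm_sq
  refine ⟨Real.arccos (y.1 2), ⟨Real.arccos_nonneg _, Real.arccos_le_pi _⟩, Complex.arg z,
    Ioc_subset_Icc_self (Complex.arg_mem_Ioc z), Subtype.ext (PiLp.ext fun i => ?_)⟩
  simp only [spherePoint]
  rw [← norm_z, Complex.norm_mul_cos_arg, Complex.norm_mul_sin_arg,
    Real.cos_arccos (neg_le_of_abs_le abs_le) (le_of_abs_le abs_le)]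
  fin_cases i <;> rfl

theorem isExhaustedByContinua_compl_poles :
    IsExhaustedByContinua ({northPole, southPole}ᶜ : Set S2) := by
  intro C hC compact
  rcases C.eq_empty_or_nonempty with rfl | ⟨y, hy⟩
  · exact ⟨∅, empty_subset _, isCompact_empty, isPreconnected_empty, Subset.rfl⟩
  set box : Set (ℝ × ℝ) := Icc 0 Real.pi ×ˢ Icc (-Real.pi) Real.pi
  set colatitudes : Set ℝ := Prod.fst '' (box ∩ (fun q => spherePoint q.1 q.2) ⁻¹' C)
  have mem_Ioo {α : ℝ} (hα : α ∈ colatitudes) : α ∈ Ioo 0 Real.pi := by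
    obtain ⟨q, ⟨hq, hqC⟩, rfl⟩ := hα
    exact (spherePoint_notMem_poles_iff hq.1).1 (hC hqC)
  have isCompact_colatitudes : IsCompact colatitudes :=
    ((isCompact_Icc.prod isCompact_Icc).inter_right
      (compact.isClosed.preimage continuous_spherePoint)).image continuous_fst
  have mem_colatitudes {α β : ℝ} (hα : α ∈ Icc 0 Real.pi) (hβ : β ∈ Icc (-Real.pi) Real.pi)
      (hy : spherePoint α β ∈ C) : α ∈ colatitudes := ⟨(α, β), ⟨⟨hα, hβ⟩, hy⟩, rfl⟩
  have nonempty : colatitudes.Nonempty := by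
    obtain ⟨α, hα, β, hβ, rfl⟩ := exists_spherePoint_eq y
    exact ⟨α, mem_colatitudes hα hβ hy⟩
  obtain ⟨a, ha⟩ := isCompact_colatitudes.exists_isLeast nonempty
  obtain ⟨b, hb⟩ := isCompact_colatitudes.exists_isGreatest nonempty
  refine ⟨(fun q : ℝ × ℝ => spherePoint q.1 q.2) '' (Icc a b ×ˢ Icc (-Real.pi) Real.pi), ?_,
    (isCompact_Icc.prod isCompact_Icc).image continuous_spherePoint,
    (isPreconnected_Icc.prod isPreconnected_Icc).image _ continuous_spherePoint.continuousOn, ?_⟩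
  · rintro _ ⟨q, ⟨hq, -⟩, rfl⟩
    have hα : q.1 ∈ Ioo 0 Real.pi :=
      ⟨(mem_Ioo ha.1).1.trans_le hq.1, hq.2.trans_lt (mem_Ioo hb.1).2⟩
    exact (spherePoint_notMem_poles_iff (Ioo_subset_Icc_self hα)).2 hα
  · intro y hy
    obtain ⟨α, hα, β, hβ, rfl⟩ := exists_spherePoint_eq y
    have := mem_colatitudes hα hβ hy
    exact ⟨(α, β), ⟨⟨ha.2 this, hb.2 this⟩, hβ⟩, rfl⟩

/-! ### Simple closed curves -/

section SimpleClosed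

variable {X : Type*} {γ : ℝ → X} {ℓ : ℝ}

theorem exists_eq_add_int_mul (hℓ : 0 < ℓ) (periodic : Function.Periodic γ ℓ)
    (simple : InjOn γ (Ico 0 ℓ)) {t t' : ℝ} (eq : γ t = γ t') : ∃ k : ℤ, t' = t + k * ℓ := by
  have map_toIcoMod (t : ℝ) : γ (toIcoMod hℓ 0 t) = γ t := periodic.sub_zsmul_eq _
  have mem_Ico (t : ℝ) : toIcoMod hℓ 0 t ∈ Ico 0 ℓ := by simpa using toIcoMod_mem_Ico hℓ 0 t
  have mod_eq := simple (mem_Ico t) (mem_Ico t') (by rw [map_toIcoMod, map_toIcoMod, eq])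
  refine ⟨toIcoDiv hℓ 0 t' - toIcoDiv hℓ 0 t, ?_⟩
  rw [toIcoMod, toIcoMod, zsmul_eq_mul, zsmul_eq_mul] at mod_eq
  push_cast
  linarith

variable [TopologicalSpace X] [T2Space X]

theorem nhdsWithin_range_le_map_nhds (continuous : Continuous γ) (hℓ : 0 < ℓ)
    (periodic : Function.Periodic γ ℓ) (simple : InjOn γ (Ico 0 ℓ)) (t₀ : ℝ) :
    𝓝[range γ] (γ t₀) ≤ map γ (𝓝 t₀) := by
  intro S hS
  obtain ⟨O, hOS, isOpen, mem⟩ := mem_nhds_iff.1 (mem_map.1 hS)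
  set period := Icc (t₀ - ℓ / 2) (t₀ - ℓ / 2 + ℓ)
  have isClosed : IsClosed (γ '' (period \ O)) :=
    ((isCompact_Icc.diff isOpen).image continuous).isClosed
  have notMem : γ t₀ ∉ γ '' (period \ O) := by
    rintro ⟨t, ⟨⟨left, right⟩, hO⟩, eq⟩
    obtain ⟨k, rfl⟩ := exists_eq_add_int_mul hℓ periodic simple eq.symm
    have lt_one : (k : ℝ) < 1 := by nlinarith
    have neg_one_lt : (-1 : ℝ) < k := by nlinarith
    obtain rfl : k = 0 := by
      have : k < 1 := mod_cast lt_one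
      have : -1 < k := mod_cast neg_one_lt
      lia
    exact hO (by simpa using mem)
  filter_upwards [mem_nhdsWithin_of_mem_nhds (isClosed.isOpen_compl.mem_nhds notMem),
    self_mem_nhdsWithin] with x hx range_mem
  rw [← periodic.image_Icc hℓ (t₀ - ℓ / 2)] at range_mem
  obtain ⟨t, ht, rfl⟩ := range_mem
  exact hOS (not_not.1 fun hO => hx ⟨t, ⟨ht, hO⟩, rfl⟩)

theorem continuousOn_comp_invFun (continuous : Continuous γ) (hℓ : 0 < ℓ)
    (periodic : Function.Periodic γ ℓ) (simple : InjOn γ (Ico 0 ℓ)) {Y : Type*}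
    [TopologicalSpace Y] {g : ℝ → Y} (hg : Continuous g) (hgℓ : Function.Periodic g ℓ) :
    ContinuousOn (g ∘ Function.invFun γ) (range γ) := by
  have factors (t : ℝ) : g (Function.invFun γ (γ t)) = g t := by
    obtain ⟨k, hk⟩ := exists_eq_add_int_mul hℓ periodic simple
      (Function.invFun_eq (mem_range_self t) : γ (Function.invFun γ (γ t)) = γ t).symm
    rw [hk, hgℓ.int_mul k t]
  rintro _ ⟨t, rfl⟩
  refine Tendsto.mono_left ?_ (nhdsWithin_range_le_map_nhds continuous hℓ periodic simple t)
  rw [tendsto_map'_iff, Function.comp_apply, factors]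
  exact (hg.tendsto t).congr fun s => (factors s).symm

end SimpleClosed

theorem periodic_tangentLift {M : Type*} [TopologicalSpace M] [ChartedSpace Plane M]
    [IsManifold (𝓡 2) ∞ M] {γ : ℝ → M} {ℓ : ℝ} (smooth : ContMDiff 𝓘(ℝ, ℝ) (𝓡 2) ∞ γ)
    (periodic : Function.Periodic γ ℓ) : Function.Periodic (tangentLift γ) ℓ := by
  intro t
  have he : chartAt Plane (γ t) ∈ IsManifold.maximalAtlas (𝓡 2) ∞ M :=
    IsManifold.chart_mem_maximalAtlas _
  have ht := mem_chart_source Plane (γ t)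
  have ht' : γ (t + ℓ) ∈ (chartAt Plane (γ t)).source := by rwa [periodic t]
  refine eq_of_coordVec_eq he ht' (periodic t) ?_
  have deriv := hasDerivAt_chart_comp he ((smooth t).mdifferentiableAt (by simp)) ht
  have deriv_shift := (hasDerivAt_chart_comp he ((smooth (t + ℓ)).mdifferentiableAt (by simp))
    ht').comp_add_const t ℓ
  simp only [periodic _] at deriv_shift
  exact deriv_shift.unique deriv

/-! ### Unit vectors along a simple closed geodesic -/

section Orientation

variable {M : Type*} [TopologicalSpace M] [ChartedSpace Plane M]
  {e e' : OpenPartialHomeomorph M Plane}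

theorem coordVec_change (he : e ∈ IsManifold.maximalAtlas (𝓡 2) ∞ M)
    (he' : e' ∈ IsManifold.maximalAtlas (𝓡 2) ∞ M) {v : TangentBundle (𝓡 2) M}
    (hv : v.1 ∈ e.source) (hv' : v.1 ∈ e'.source) :
    coordVec e v = fderiv ℝ (e ∘ e'.symm) (e' v.1) (coordVec e' v) := by
  have diff_e' : MDifferentiableAt (𝓡 2) (𝓡 2) e' v.1 :=
    (contMDiffAt_of_mem_maximalAtlas he' hv').mdifferentiableAt (by simp)
  have diff_symm : MDifferentiableAt (𝓡 2) (𝓡 2) e'.symm (e' v.1) :=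
    (contMDiffAt_symm_of_mem_maximalAtlas he' (e'.map_source hv')).mdifferentiableAt (by simp)
  have diff_e : MDifferentiableAt (𝓡 2) (𝓡 2) e (e'.symm (e' v.1)) := by
    rw [e'.left_inv hv']
    exact (contMDiffAt_of_mem_maximalAtlas he hv).mdifferentiableAt (by simp)
  have eq_comp : e =ᶠ[𝓝 v.1] (e ∘ e'.symm) ∘ e' := by
    filter_upwards [e'.open_source.mem_nhds hv'] with x hx
    simp [e'.left_inv hx]
  have mfderiv_eq := eq_comp.mfderiv_eq (I := 𝓡 2) (I' := 𝓡 2)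
  rw [mfderiv_comp v.1 (diff_e.comp _ diff_symm) diff_e', mfderiv_eq_fderiv] at mfderiv_eq
  exact congrArg (fun L : Plane →L[ℝ] Plane => L v.2) mfderiv_eq

theorem isPositivePair_iff [IsManifold (𝓡 2) ∞ M] {𝒜 : Set (OpenPartialHomeomorph M Plane)}
    (h𝒜 : IsOrientedAtlas 𝒜) (he : e ∈ 𝒜) {x : M} (hx : x ∈ e.source)
    (u w : TangentSpace (𝓡 2) x) :
    IsPositivePair 𝒜 x u w ↔ 0 < cross (coordVec e ⟨x, u⟩) (coordVec e ⟨x, w⟩) := by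
  refine ⟨?_, fun pos => ⟨e, he, hx, pos⟩⟩
  rintro ⟨e', he', hx', pos⟩
  rw [coordVec_change (h𝒜.1 he) (h𝒜.1 he') (v := ⟨x, u⟩) hx hx',
    coordVec_change (h𝒜.1 he) (h𝒜.1 he') (v := ⟨x, w⟩) hx hx', cross_map]
  exact mul_pos (h𝒜.det_pos e' he' e he x ⟨hx', hx⟩) pos

end Orientation

section VelocityField

variable {M : Type*} [TopologicalSpace M] [ChartedSpace Plane M]

/-- The velocity of a simple closed curve `γ` as a vector field along its image. The value at `x` is
the velocity at some parameter `t` with `γ t = x`, regarded as a tangent vector at `x`; it is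
meaningless for `x ∉ range γ`. -/
def velocityField (γ : ℝ → M) (x : M) : TangentSpace (𝓡 2) x := velocity γ (Function.invFun γ x)

theorem mk_velocityField {γ : ℝ → M} {x : M} (hx : x ∈ range γ) :
    (⟨x, velocityField γ x⟩ : TangentBundle (𝓡 2) M) = tangentLift γ (Function.invFun γ x) := by
  have transport {y : M} (w : TangentSpace (𝓡 2) y) (eq : y = x) :
      (⟨x, w⟩ : TangentBundle (𝓡 2) M) = ⟨y, w⟩ := by
    subst eq
    rfl
  exact transport _ (Function.invFun_eq hx)

variable [IsManifold (𝓡 2) ∞ M] [RiemannianBundle (fun x : M => TangentSpace (𝓡 2) x)]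
  {γ : ℝ → M} {ℓ : ℝ}

namespace IsSimpleClosedGeodesic

theorem exists_eq_add_int_mul (hγ : IsSimpleClosedGeodesic γ ℓ) {t t' : ℝ} (eq : γ t = γ t') :
    ∃ k : ℤ, t' = t + k * ℓ :=
  GeodesicReturn.exists_eq_add_int_mul hγ.length_pos hγ.periodic hγ.simple eq

theorem velocityField_apply (hγ : IsSimpleClosedGeodesic γ ℓ) (t : ℝ) :
    velocityField γ (γ t) = velocity γ t := by
  obtain ⟨k, hk⟩ := hγ.exists_eq_add_int_mul
    (Function.invFun_eq (mem_range_self t) : γ (Function.invFun γ (γ t)) = γ t).symm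
  have lift_eq := mk_velocityField (mem_range_self (f := γ) t)
  rw [hk, (periodic_tangentLift hγ.geodesic.smooth hγ.periodic).int_mul k t] at lift_eq
  exact TotalSpace.mk_inj.1 lift_eq

theorem norm_velocityField (hγ : IsSimpleClosedGeodesic γ ℓ) {x : M} (hx : x ∈ range γ) :
    ‖velocityField γ x‖ = 1 := by
  obtain ⟨t, rfl⟩ := hx
  rw [hγ.velocityField_apply, hγ.geodesic.unit_speed]

variable [T2Space M]

theorem nhdsWithin_range_le_map_nhds (hγ : IsSimpleClosedGeodesic γ ℓ) (t : ℝ) :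
    𝓝[range γ] (γ t) ≤ map γ (𝓝 t) :=
  GeodesicReturn.nhdsWithin_range_le_map_nhds hγ.geodesic.smooth.continuous hγ.length_pos
    hγ.periodic hγ.simple t

theorem continuousOn_comp_invFun (hγ : IsSimpleClosedGeodesic γ ℓ) {Y : Type*}
    [TopologicalSpace Y] {g : ℝ → Y} (hg : Continuous g) (hgℓ : Function.Periodic g ℓ) :
    ContinuousOn (g ∘ Function.invFun γ) (range γ) :=
  GeodesicReturn.continuousOn_comp_invFun hγ.geodesic.smooth.continuous hγ.length_pos
    hγ.periodic hγ.simple hg hgℓ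

theorem continuousOn_velocityField (hγ : IsSimpleClosedGeodesic γ ℓ) :
    ContinuousOn (fun x => (⟨x, velocityField γ x⟩ : TangentBundle (𝓡 2) M)) (range γ) :=
  (hγ.continuousOn_comp_invFun (continuous_tangentLift hγ.geodesic.smooth)
    (periodic_tangentLift hγ.geodesic.smooth hγ.periodic)).congr fun _ hx => mk_velocityField hx

theorem isClosed_range (hγ : IsSimpleClosedGeodesic γ ℓ) : IsClosed (range γ) := by
  rw [← hγ.periodic.image_Icc hγ.length_pos 0]
  exact (isCompact_Icc.image hγ.geodesic.smooth.continuous).isClosed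

end IsSimpleClosedGeodesic

end VelocityField

section UnitAlong

variable {M : Type*} [TopologicalSpace M] [ChartedSpace Plane M] [IsManifold (𝓡 2) ∞ M]
  [RiemannianBundle (fun x : M => TangentSpace (𝓡 2) x)]
  {𝒜 : Set (OpenPartialHomeomorph M Plane)} {e : OpenPartialHomeomorph M Plane}
  {γ : ℝ → M} {ℓ : ℝ}

theorem continuous_unitTangent_proj : Continuous fun v : UnitTangent M => v.1.proj :=
  (FiberBundle.continuous_proj Plane (TangentSpace (𝓡 2))).comp continuous_subtype_val

theorem continuousAt_coordVec_unitTangent (he : e ∈ IsManifold.maximalAtlas (𝓡 2) ∞ M)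
    {v : UnitTangent M} (hv : v.1.proj ∈ e.source) :
    ContinuousAt (fun v : UnitTangent M => coordVec e v.1) v :=
  ((continuousOn_coordVec he).comp continuous_subtype_val.continuousOn fun _ hw => hw).continuousAt
    ((e.open_source.preimage continuous_unitTangent_proj).mem_nhds hv)

/-- The unit vectors based at points of the curve `γ`. -/
def unitAlong (γ : ℝ → M) : Set (UnitTangent M) := {v | v.1.proj ∈ range γ}

theorem continuousOn_comp_proj {Y : Type*} [TopologicalSpace Y] {g : M → Y}
    (hg : ContinuousOn g (range γ)) :
    ContinuousOn (fun v : UnitTangent M => g v.1.proj) (unitAlong γ) :=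
  hg.comp continuous_unitTangent_proj.continuousOn fun _ hv => hv

/-- The closure of the annulus: it contains also the velocity vectors of `γ` and of the reversed
curve. -/
def closedAnnulus (𝒜 : Set (OpenPartialHomeomorph M Plane)) (γ : ℝ → M) : Set (UnitTangent M) :=
  {v | v ∈ annulus 𝒜 γ ∨ v.1 ∈ range (tangentLift γ) ∨ v.1 ∈ range (tangentLift fun t => γ (-t))}

theorem annulus_subset_unitAlong : annulus 𝒜 γ ⊆ unitAlong γ := by
  rintro v ⟨t, w, eq, -⟩
  exact ⟨t, (congrArg TotalSpace.proj eq).symm⟩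

theorem closedAnnulus_subset_unitAlong : closedAnnulus 𝒜 γ ⊆ unitAlong γ := by
  rintro v (hv | ⟨t, eq⟩ | ⟨t, eq⟩)
  · exact annulus_subset_unitAlong hv
  · exact ⟨t, congrArg TotalSpace.proj eq⟩
  · exact ⟨-t, congrArg TotalSpace.proj eq⟩

theorem mem_annulus_iff_isPositivePair (hγ : IsSimpleClosedGeodesic γ ℓ) {v : UnitTangent M} :
    v ∈ annulus 𝒜 γ ↔
      v ∈ unitAlong γ ∧ IsPositivePair 𝒜 v.1.proj (velocityField γ v.1.proj) v.1.2 := by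
  obtain ⟨v, hv⟩ := v
  constructor
  · rintro ⟨t, w, eq, pos⟩
    rw [← hγ.velocityField_apply] at pos
    obtain rfl : v = ⟨γ t, w⟩ := eq
    exact ⟨⟨t, rfl⟩, pos⟩
  · obtain ⟨x, w⟩ := v
    rintro ⟨⟨t, eq⟩, pos⟩
    obtain rfl : γ t = x := eq
    rw [hγ.velocityField_apply] at pos
    exact ⟨t, w, rfl, pos⟩

theorem mem_range_tangentLift_iff (hγ : IsSimpleClosedGeodesic γ ℓ) {v : UnitTangent M} :
    v.1 ∈ range (tangentLift γ) ↔ v ∈ unitAlong γ ∧ v.1.2 = velocityField γ v.1.proj := by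
  obtain ⟨v, hv⟩ := v
  constructor
  · rintro ⟨t, eq⟩
    obtain rfl : tangentLift γ t = v := eq
    exact ⟨⟨t, rfl⟩, (hγ.velocityField_apply t).symm⟩
  · obtain ⟨x, w⟩ := v
    rintro ⟨⟨t, eq⟩, vector_eq⟩
    obtain rfl : γ t = x := eq
    exact ⟨t, congrArg (TotalSpace.mk (γ t)) (vector_eq.trans (hγ.velocityField_apply t)).symm⟩

theorem mem_range_tangentLift_comp_neg_iff (hγ : IsSimpleClosedGeodesic γ ℓ) {v : UnitTangent M} :
    v.1 ∈ range (tangentLift fun t => γ (-t)) ↔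
      v ∈ unitAlong γ ∧ v.1.2 = -velocityField γ v.1.proj := by
  have lift_eq (t : ℝ) : tangentLift (fun s => γ (-s)) t = ⟨γ (-t), -velocity γ (-t)⟩ :=
    tangentLift_comp_neg ((hγ.geodesic.smooth (-t)).mdifferentiableAt (by simp))
  obtain ⟨v, hv⟩ := v
  constructor
  · rintro ⟨t, eq⟩
    obtain rfl : v = ⟨γ (-t), -velocity γ (-t)⟩ := eq.symm.trans (lift_eq t)
    exact ⟨⟨-t, rfl⟩, congrArg Neg.neg (hγ.velocityField_apply (-t)).symm⟩
  · obtain ⟨x, w⟩ := v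
    rintro ⟨⟨t, eq⟩, vector_eq⟩
    obtain rfl : γ t = x := eq
    refine ⟨-t, (lift_eq (-t)).trans ?_⟩
    rw [neg_neg, ← hγ.velocityField_apply]
    exact congrArg (TotalSpace.mk (γ t)) vector_eq.symm

/-- The oriented area, in the chart `e`, spanned by the velocity of `γ` and by `v`. -/
def signedArea (e : OpenPartialHomeomorph M Plane) (γ : ℝ → M) (v : UnitTangent M) : ℝ :=
  cross (coordVec e ⟨v.1.proj, velocityField γ v.1.proj⟩) (coordVec e v.1)

theorem mem_annulus_iff (h𝒜 : IsOrientedAtlas 𝒜) (hγ : IsSimpleClosedGeodesic γ ℓ) (he : e ∈ 𝒜)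
    {v : UnitTangent M} (along : v ∈ unitAlong γ) (hv : v.1.proj ∈ e.source) :
    v ∈ annulus 𝒜 γ ↔ 0 < signedArea e γ v := by
  rw [mem_annulus_iff_isPositivePair hγ, and_iff_right along, isPositivePair_iff h𝒜 he hv]
  rfl

theorem signedArea_eq_zero_iff (hγ : IsSimpleClosedGeodesic γ ℓ)
    (he : e ∈ IsManifold.maximalAtlas (𝓡 2) ∞ M) {v : UnitTangent M} (along : v ∈ unitAlong γ)
    (hv : v.1.proj ∈ e.source) :
    signedArea e γ v = 0 ↔
      v.1.2 = velocityField γ v.1.proj ∨ v.1.2 = -velocityField γ v.1.proj := by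
  set L : TangentSpace (𝓡 2) v.1.proj →L[ℝ] Plane := mfderiv (𝓡 2) (𝓡 2) e v.1.proj
  refine ⟨fun area => eq_or_eq_neg_of_cross_eq_zero (L := L.toLinearMap)
    ((mdifferentiable_of_mem_maximalAtlas he).mfderiv_bijective hv)
    (hγ.norm_velocityField along) v.2 area, fun parallel => ?_⟩
  change cross (L (velocityField γ v.1.proj)) (L v.1.2) = 0
  rcases parallel with eq | eq
  · rw [eq, cross_self]
  · rw [eq, ← neg_one_smul ℝ, map_smul, cross_smul_right, cross_self, mul_zero]

theorem mem_closedAnnulus_iff (h𝒜 : IsOrientedAtlas 𝒜) (hγ : IsSimpleClosedGeodesic γ ℓ)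
    (he : e ∈ 𝒜) {v : UnitTangent M} (along : v ∈ unitAlong γ) (hv : v.1.proj ∈ e.source) :
    v ∈ closedAnnulus 𝒜 γ ↔ 0 ≤ signedArea e γ v := by
  rw [le_iff_lt_or_eq, ← mem_annulus_iff h𝒜 hγ he along hv, eq_comm (a := 0),
    signedArea_eq_zero_iff hγ (h𝒜.1 he) along hv, closedAnnulus, mem_ofPred_eq,
    mem_range_tangentLift_iff hγ, mem_range_tangentLift_comp_neg_iff hγ, and_iff_right along,
    and_iff_right along]

variable [T2Space M]

theorem continuousWithinAt_signedArea (hγ : IsSimpleClosedGeodesic γ ℓ)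
    (he : e ∈ IsManifold.maximalAtlas (𝓡 2) ∞ M) {v : UnitTangent M} (along : v ∈ unitAlong γ)
    (hv : v.1.proj ∈ e.source) : ContinuousWithinAt (signedArea e γ) (unitAlong γ) v := by
  have field : ContinuousWithinAt (fun v : UnitTangent M =>
      coordVec e ⟨v.1.proj, velocityField γ v.1.proj⟩) (unitAlong γ) v :=
    ContinuousAt.comp_continuousWithinAt
      (f := fun v : UnitTangent M =>
        (⟨v.1.proj, velocityField γ v.1.proj⟩ : TangentBundle (𝓡 2) M))
      ((continuousOn_coordVec he).continuousAt ((e.open_source.preimage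
        (FiberBundle.continuous_proj Plane (TangentSpace (𝓡 2)))).mem_nhds hv))
      (continuousOn_comp_proj hγ.continuousOn_velocityField v along)
  have vector := (continuousAt_coordVec_unitTangent he hv).continuousWithinAt (s := unitAlong γ)
  unfold signedArea cross
  fun_prop

theorem isClosed_unitAlong (hγ : IsSimpleClosedGeodesic γ ℓ) : IsClosed (unitAlong γ) :=
  hγ.isClosed_range.preimage continuous_unitTangent_proj

theorem isClosed_closedAnnulus (h𝒜 : IsOrientedAtlas 𝒜) (hγ : IsSimpleClosedGeodesic γ ℓ) :
    IsClosed (closedAnnulus 𝒜 γ) := by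
  refine isClosed_of_closure_subset fun v hv => ?_
  have along : v ∈ unitAlong γ :=
    closure_minimal closedAnnulus_subset_unitAlong (isClosed_unitAlong hγ) hv
  obtain ⟨e, he, hve⟩ := h𝒜.covers v.1.proj
  rw [mem_closedAnnulus_iff h𝒜 hγ he along hve]
  have := mem_closure_iff_nhdsWithin_neBot.1 hv
  refine ge_of_tendsto ((continuousWithinAt_signedArea hγ (h𝒜.1 he) along hve).mono
    (closedAnnulus_subset_unitAlong (𝒜 := 𝒜))) ?_
  filter_upwards [self_mem_nhdsWithin, mem_nhdsWithin_of_mem_nhds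
    ((e.open_source.preimage continuous_unitTangent_proj).mem_nhds hve)] with w hw hwe
  exact (mem_closedAnnulus_iff h𝒜 hγ he (closedAnnulus_subset_unitAlong hw) hwe).1 hw

theorem eventually_mem_annulus (h𝒜 : IsOrientedAtlas 𝒜) (hγ : IsSimpleClosedGeodesic γ ℓ)
    {v₀ : UnitTangent M} (hv₀ : v₀ ∈ annulus 𝒜 γ) :
    ∀ᶠ v in 𝓝[unitAlong γ] v₀, v ∈ annulus 𝒜 γ := by
  obtain ⟨e, he, hve⟩ := h𝒜.covers v₀.1.proj
  have along := annulus_subset_unitAlong hv₀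
  have area := (mem_annulus_iff h𝒜 hγ he along hve).1 hv₀
  filter_upwards [self_mem_nhdsWithin, mem_nhdsWithin_of_mem_nhds
      ((e.open_source.preimage continuous_unitTangent_proj).mem_nhds hve),
    (continuousWithinAt_signedArea hγ (h𝒜.1 he) along hve).eventually (lt_mem_nhds area)]
    with v hv hve area
  exact (mem_annulus_iff h𝒜 hγ he hv hve).2 area

end UnitAlong

/-! ### Polar coordinates on the closed annulus -/

section PolarMap

variable {M : Type*} [TopologicalSpace M] [ChartedSpace Plane M] [IsManifold (𝓡 2) ∞ M]
  [RiemannianBundle (fun x : M => TangentSpace (𝓡 2) x)]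
  {𝒜 : Set (OpenPartialHomeomorph M Plane)} {γ : ℝ → M} {ℓ : ℝ}

/-- The extension of `annulusToSphere` to all unit vectors along `γ`: the colatitude is the angle
with `γ`, and the longitude is the position on `γ`. -/
def polarMap (γ : ℝ → M) (ℓ : ℝ) (v : UnitTangent M) : S2 :=
  spherePoint (InnerProductGeometry.angle (velocityField γ v.1.proj) v.1.2)
    (2 * Real.pi * Function.invFun γ v.1.proj / ℓ)

theorem periodic_comp_longitude (hℓ : ℓ ≠ 0) {g : ℝ → ℝ} (hg : Function.Periodic g (2 * Real.pi)) :
    Function.Periodic (fun t => g (2 * Real.pi * t / ℓ)) ℓ := fun t => by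
  beta_reduce
  rw [mul_add, add_div, mul_div_cancel_right₀ _ hℓ, hg]

theorem polarMap_eq (hγ : IsSimpleClosedGeodesic γ ℓ) {v : UnitTangent M} {t : ℝ}
    {w : TangentSpace (𝓡 2) (γ t)} (hv : v.1 = ⟨γ t, w⟩) :
    polarMap γ ℓ v =
      spherePoint (InnerProductGeometry.angle (velocity γ t) w) (2 * Real.pi * t / ℓ) := by
  obtain ⟨v, norm_v⟩ := v
  obtain rfl : v = ⟨γ t, w⟩ := hv
  obtain ⟨k, hk⟩ := hγ.exists_eq_add_int_mul
    (Function.invFun_eq (mem_range_self t) : γ (Function.invFun γ (γ t)) = γ t).symm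
  have factors {g : ℝ → ℝ} (hg : Function.Periodic g (2 * Real.pi)) :
      g (2 * Real.pi * Function.invFun γ (γ t) / ℓ) = g (2 * Real.pi * t / ℓ) := by
    rw [hk]
    exact (periodic_comp_longitude hγ.length_pos.ne' hg).int_mul k t
  simp only [polarMap, spherePoint_eq_iff, hγ.velocityField_apply, factors Real.cos_periodic,
    factors Real.sin_periodic, and_self]

theorem annulusToSphere_eq_polarMap (hγ : IsSimpleClosedGeodesic γ ℓ) (v : annulus 𝒜 γ) :
    annulusToSphere 𝒜 γ ℓ v = polarMap γ ℓ v :=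
  (polarMap_eq hγ v.2.choose_spec.choose_spec.1).symm

theorem continuousOn_polarMap [T2Space M]
    [IsContinuousRiemannianBundle Plane (fun x : M => TangentSpace (𝓡 2) x)]
    (hγ : IsSimpleClosedGeodesic γ ℓ) : ContinuousOn (polarMap γ ℓ) (unitAlong γ) := by
  intro v hv
  have longitude {g : ℝ → ℝ} (hg : Function.Periodic g (2 * Real.pi)) (continuous : Continuous g) :
      ContinuousWithinAt (fun v : UnitTangent M =>
        g (2 * Real.pi * Function.invFun γ v.1.proj / ℓ)) (unitAlong γ) v :=
    continuousOn_comp_proj (hγ.continuousOn_comp_invFun (g := fun t => g (2 * Real.pi * t / ℓ))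
      (by fun_prop) (periodic_comp_longitude hγ.length_pos.ne' hg)) v hv
  refine continuousWithinAt_spherePoint ?_ (longitude Real.cos_periodic Real.continuous_cos)
    (longitude Real.sin_periodic Real.continuous_sin)
  have inner : ContinuousWithinAt (fun v : UnitTangent M =>
      inner ℝ (velocityField γ v.1.proj) v.1.2) (unitAlong γ) v :=
    ContinuousWithinAt.inner_bundle (F := Plane) (E := fun x : M => TangentSpace (𝓡 2) x)
      (b := fun v : UnitTangent M => v.1.proj)
      (continuousOn_comp_proj hγ.continuousOn_velocityField v hv)
      continuous_subtype_val.continuousWithinAt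
  refine (Real.continuous_arccos.continuousAt.comp_continuousWithinAt inner).congr (fun w hw => ?_)
    ?_
  · rw [InnerProductGeometry.angle, hγ.norm_velocityField hw, w.2, mul_one, div_one]
    rfl
  · rw [InnerProductGeometry.angle, hγ.norm_velocityField hv, v.2, mul_one, div_one]
    rfl

end PolarMap

/-! ### Plane curves as level sets -/

section DefiningFunction

variable {c : ℝ → Plane} {t₀ : ℝ} {a : Plane}

theorem exists_local_parameter (hc : ContDiffAt ℝ 1 c t₀) (deriv : HasDerivAt c a t₀)
    (ha : a ≠ 0) :
    ∃ ρ : Plane → ℝ, ContDiffAt ℝ 1 ρ (c t₀) ∧ (∀ᶠ t in 𝓝 t₀, ρ (c t) = t) ∧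
      ∀ᶠ x in 𝓝 (c t₀), inner ℝ a (c (ρ x)) = inner ℝ a x := by
  have height : ContDiffAt ℝ 1 (fun t => innerSL ℝ a (c t)) t₀ :=
    (innerSL ℝ a).contDiff.contDiffAt.comp t₀ hc
  have height_deriv := (((innerSL ℝ a).hasFDerivAt.comp_hasDerivAt t₀ deriv).hasFDerivAt_equiv
    (inner_self_ne_zero.2 ha))
  have strict := height.hasStrictFDerivAt' height_deriv one_ne_zero
  exact ⟨fun x => height.localInverse height_deriv one_ne_zero (innerSL ℝ a x),
    ContDiffAt.comp (c t₀) (height.to_localInverse height_deriv one_ne_zero)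
      (innerSL ℝ a).contDiff.contDiffAt,
    strict.eventually_left_inverse,
    (innerSL ℝ a).continuous.continuousAt.eventually strict.eventually_right_inverse⟩

theorem exists_local_defining_function (hc : ContDiffAt ℝ 1 c t₀) (deriv : HasDerivAt c a t₀)
    (ha : a ≠ 0) :
    ∃ f : Plane → ℝ, ContDiffAt ℝ 1 f (c t₀) ∧ (∀ b, fderiv ℝ f (c t₀) b = cross a b) ∧
      (∀ᶠ t in 𝓝 t₀, f (c t) = 0) ∧
      ∀ U ∈ 𝓝 t₀, ∀ᶠ x in 𝓝 (c t₀), f x = 0 → ∃ t ∈ U, c t = x := by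
  obtain ⟨ρ, hρ, left_inv, same_height⟩ := exists_local_parameter hc deriv ha
  have ρ_base : ρ (c t₀) = t₀ := left_inv.self_of_nhds
  set area := innerSL ℝ (quarterTurn a)
  have area_apply (b : Plane) : area b = cross a b := inner_quarterTurn a b
  have foot : ContDiffAt ℝ 1 (fun x => c (ρ x)) (c t₀) :=
    ContDiffAt.comp (c t₀) (by rwa [ρ_base]) hρ
  have foot_deriv : HasFDerivAt (fun x => area (c (ρ x))) (0 : Plane →L[ℝ] ℝ) (c t₀) := by
    have curve_deriv := area.hasFDerivAt.comp_hasDerivAt t₀ deriv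
    rw [area_apply, cross_self, ← ρ_base] at curve_deriv
    have chain := curve_deriv.comp_hasFDerivAt (c t₀)
      (hρ.differentiableAt one_ne_zero).hasFDerivAt
    rwa [zero_smul] at chain
  refine ⟨fun x => area x - area (c (ρ x)),
    area.contDiff.contDiffAt.sub (area.contDiff.contDiffAt.comp (c t₀) foot), fun b => ?_, ?_,
    fun U hU => ?_⟩
  · have f_deriv : HasFDerivAt (fun x => area x - area (c (ρ x))) (area - 0) (c t₀) :=
      area.hasFDerivAt.sub foot_deriv
    rw [f_deriv.fderiv, sub_zero, area_apply]
  · filter_upwards [left_inv] with t ht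
    rw [ht, sub_self]
  · have tendsto : Tendsto ρ (𝓝 (c t₀)) (𝓝 t₀) := by
      simpa only [ρ_base] using hρ.continuousAt.tendsto
    filter_upwards [tendsto hU, same_height] with x hx height_eq area_eq
    refine ⟨ρ x, hx, eq_of_inner_eq_of_cross_eq ha height_eq ?_⟩
    simpa only [area_apply] using (sub_eq_zero.1 area_eq).symm

end DefiningFunction

/-! ### Crossing functions of a flow -/

/-- Over `W`, the set `A` is the zero set of the continuous function `φ`, which increases along the
orbits of `Φ`: this expresses that `A` is a hypersurface transverse to the flow. -/
structure IsCrossingFunction {X : Type*} [TopologicalSpace X] (Φ : Flow ℝ X) (A W : Set X)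
    (φ : X → ℝ) : Prop where
  mem_iff : ∀ u ∈ W, u ∈ A ↔ φ u = 0
  hasDerivAt : ∀ u ∈ W, ∃ d > 0, HasDerivAt (fun s => φ (Φ s u)) d 0
  continuousAt : ∀ u ∈ W, ContinuousAt φ u

section CrossingFunction

variable {X : Type*} [TopologicalSpace X] {Φ : Flow ℝ X} {A W : Set X} {v : X} {φ : X → ℝ}

theorem exists_eventually_flow_mem (Φ : Flow ℝ X) (hW : W ∈ 𝓝 v) :
    ∃ ε > 0, ∀ᶠ u in 𝓝 v, ∀ s, |s| < ε → Φ s u ∈ W := by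
  have flow : Tendsto (fun q : X × ℝ => Φ q.2 q.1) (𝓝 v ×ˢ 𝓝 0) (𝓝 v) := by
    rw [← nhds_prod_eq]
    exact (Φ.continuous continuous_snd continuous_fst).tendsto' _ _ (Φ.map_zero_apply v)
  obtain ⟨U, hU, I, hI, sub⟩ := mem_prod_iff.1 (flow hW)
  obtain ⟨ε, hε, ball_sub⟩ := Metric.mem_nhds_iff.1 hI
  refine ⟨ε, hε, ?_⟩
  filter_upwards [hU] with u hu s hs
  exact sub (mk_mem_prod hu (ball_sub (by simpa using hs)))

namespace IsCrossingFunction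

theorem hasDerivAt_flow (h : IsCrossingFunction Φ A W φ) {u : X} {s : ℝ} (hs : Φ s u ∈ W) :
    ∃ d > 0, HasDerivAt (fun s => φ (Φ s u)) d s := by
  obtain ⟨d, hd, deriv⟩ := h.hasDerivAt _ hs
  refine ⟨d, hd, ?_⟩
  have shifted : HasDerivAt (fun r => φ (Φ (r - s) (Φ s u))) d s :=
    HasDerivAt.comp_sub_const s s (by rwa [sub_self])
  simpa only [← Φ.map_add, sub_add_cancel] using shifted

theorem continuousOn_flow (h : IsCrossingFunction Φ A W φ) {ε : ℝ} {u : X}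
    (hu : ∀ s, |s| < ε → Φ s u ∈ W) : ContinuousOn (fun s => φ (Φ s u)) (Ioo (-ε) ε) :=
  fun s hs =>
    have ⟨_, _, deriv⟩ := h.hasDerivAt_flow (hu s (abs_lt.2 hs))
    deriv.continuousAt.continuousWithinAt

theorem strictMonoOn_flow (h : IsCrossingFunction Φ A W φ) {ε : ℝ} {u : X}
    (hu : ∀ s, |s| < ε → Φ s u ∈ W) : StrictMonoOn (fun s => φ (Φ s u)) (Ioo (-ε) ε) := by
  refine strictMonoOn_of_deriv_pos (convex_Ioo _ _) (h.continuousOn_flow hu) fun s hs => ?_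
  rw [interior_Ioo] at hs
  obtain ⟨d, hd, deriv⟩ := h.hasDerivAt_flow (hu s (abs_lt.2 hs))
  rwa [deriv.deriv]

theorem exists_eventually_subsingleton (h : IsCrossingFunction Φ A W φ) (hW : W ∈ 𝓝 v) :
    ∃ ε > 0, ∀ᶠ u in 𝓝 v, {s | |s| < ε ∧ Φ s u ∈ A}.Subsingleton := by
  obtain ⟨ε, hε, stays⟩ := exists_eventually_flow_mem Φ hW
  refine ⟨ε, hε, ?_⟩
  filter_upwards [stays] with u hu s ⟨hs, hA⟩ s' ⟨hs', hA'⟩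
  refine (h.strictMonoOn_flow hu).injOn (abs_lt.1 hs) (abs_lt.1 hs') ?_
  rw [(h.mem_iff _ (hu s hs)).1 hA, (h.mem_iff _ (hu s' hs')).1 hA']

theorem eventually_exists_flow_mem (h : IsCrossingFunction Φ A W φ) (hW : W ∈ 𝓝 v) (hv : v ∈ A)
    {ε : ℝ} (hε : 0 < ε) : ∀ᶠ u in 𝓝 v, ∃ s, |s| < ε ∧ Φ s u ∈ A := by
  obtain ⟨δ, hδ, stays⟩ := exists_eventually_flow_mem Φ hW
  obtain ⟨r, r_pos, hr⟩ := exists_between (lt_min hε hδ)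
  obtain ⟨r_lt_ε, r_lt_δ⟩ := lt_min_iff.1 hr
  have abs_lt_δ {s : ℝ} (hs : s ∈ Icc (-r) r) : |s| < δ := (abs_le.2 hs).trans_lt r_lt_δ
  have sub : Icc (-r) r ⊆ Ioo (-δ) δ := fun s hs => abs_lt.1 (abs_lt_δ hs)
  have left_mem : -r ∈ Icc (-r) r := ⟨le_rfl, by linarith⟩
  have right_mem : r ∈ Icc (-r) r := ⟨by linarith, le_rfl⟩
  have mono := h.strictMonoOn_flow stays.self_of_nhds
  have zero : φ (Φ 0 v) = 0 := by
    rw [Φ.map_zero_apply]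
    exact (h.mem_iff _ (mem_of_mem_nhds hW)).1 hv
  have neg : φ (Φ (-r) v) < 0 :=
    zero ▸ mono (sub left_mem) ⟨neg_lt_zero.2 hδ, hδ⟩ (neg_lt_zero.2 r_pos)
  have pos : 0 < φ (Φ r v) := zero ▸ mono ⟨neg_lt_zero.2 hδ, hδ⟩ (sub right_mem) r_pos
  have continuousAt {s : ℝ} (hs : s ∈ Icc (-r) r) : ContinuousAt (fun u => φ (Φ s u)) v :=
    ContinuousAt.comp (f := fun u => Φ s u)
      (h.continuousAt _ (stays.self_of_nhds s (abs_lt_δ hs)))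
      (Φ.continuous continuous_const continuous_id).continuousAt
  filter_upwards [stays, (continuousAt left_mem).eventually (gt_mem_nhds neg),
    (continuousAt right_mem).eventually (lt_mem_nhds pos)] with u hu neg pos
  obtain ⟨s, hs, eq_zero⟩ := intermediate_value_Icc (neg_le_self r_pos.le)
    ((h.continuousOn_flow hu).mono sub) ⟨neg.le, pos.le⟩
  exact ⟨s, (abs_le.2 hs).trans_lt r_lt_ε, (h.mem_iff _ (hu s (abs_lt_δ hs))).2 eq_zero⟩

end IsCrossingFunction

end CrossingFunction

theorem IsPolarCollapse.exists_returnMap_extension {X Y : Type*} [TopologicalSpace X]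
    [CompactSpace X] [MetricSpace Y] {Φ : Flow ℝ X} {A B : Set X} {p : X → Y} {P : Set Y}
    (h : IsPolarCollapse Φ A B p P) (equi : IsEquicontinuousFlow Φ)
    (crossing : ∀ v ∈ A, ∃ W ∈ 𝓝 v, ∃ φ, IsCrossingFunction Φ A W φ)
    (hP : IsExhaustedByContinua Pᶜ) :
    ∃ (F : A → A) (F' : Y ≃ₜ Y), IsFirstReturnMap Φ A F ∧ (∀ v : A, F' (p v) = p (F v)) ∧
      (∀ y ∈ P, F' y = y) ∧ IsRecurrent F' := by
  obtain ⟨m, rfl, equi⟩ := equi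
  have hΦ : UniformEquicontinuous fun t => Φ t := Metric.uniformEquicontinuous_iff.2 fun ε hε =>
    (equi ε hε).imp fun δ ⟨hδ, close⟩ => ⟨hδ, fun x y hxy t => close x y hxy t⟩
  have hA : IsCrossSection Φ A := by
    refine .of_uniformEquicontinuous hΦ (fun v hv ε hε => ?_) (fun v hv => ?_)
      fun v hv t => h.mem_of_mem_closure hv t
    all_goals obtain ⟨W, hW, φ, hφ⟩ := crossing v hv
    · exact hφ.eventually_exists_flow_mem hW hv hε
    · exact hφ.exists_eventually_subsingleton hW
  exact ⟨hA.returnMap, h.extendedReturnMap hΦ hA, hA.isFirstReturnMap_returnMap,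
    h.extendedReturnMap_apply hΦ hA, fun _ hy => h.extendedReturnMap_of_mem hΦ hA hy,
    h.isRecurrent_extendedReturnMap hΦ hA hP⟩

/-! ### Transversality of the geodesic flow -/

section GeodesicFlow

variable {M : Type*} [TopologicalSpace M] [ChartedSpace Plane M] [IsManifold (𝓡 2) ∞ M]
  [RiemannianBundle (fun x : M => TangentSpace (𝓡 2) x)]
  {𝒜 : Set (OpenPartialHomeomorph M Plane)} {e : OpenPartialHomeomorph M Plane}
  {γ : ℝ → M} {ℓ : ℝ} {Φ : Flow ℝ (UnitTangent M)}

theorem IsSimpleClosedGeodesic.exists_local_defining_function [T2Space M]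
    (hγ : IsSimpleClosedGeodesic γ ℓ) (he : e ∈ IsManifold.maximalAtlas (𝓡 2) ∞ M) {x₀ : M}
    (hx₀ : x₀ ∈ range γ) (hx₀e : x₀ ∈ e.source) :
    ∃ f : Plane → ℝ, ContDiffAt ℝ 1 f (e x₀) ∧
      (∀ b, fderiv ℝ f (e x₀) b = cross (coordVec e ⟨x₀, velocityField γ x₀⟩) b) ∧
      ∀ᶠ x in 𝓝 x₀, x ∈ range γ ↔ f (e x) = 0 := by
  obtain ⟨t₀, rfl⟩ := hx₀
  have smooth : ContDiffAt ℝ 1 (fun t => e (γ t)) t₀ :=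
    (contMDiffAt_iff_contDiffAt.1 ((contMDiffAt_of_mem_maximalAtlas he hx₀e).comp t₀
      (hγ.geodesic.smooth t₀))).of_le (mod_cast le_top)
  have lift_ne_zero : coordVec e (tangentLift γ t₀) ≠ 0 := fun eq_zero => by
    have velocity_eq : velocity γ t₀ = 0 :=
      (mdifferentiable_of_mem_maximalAtlas he).mfderiv_injective hx₀e
        (eq_zero.trans (map_zero _).symm)
    simpa [velocity_eq] using hγ.geodesic.unit_speed t₀
  obtain ⟨f, hf, fderiv_eq, zero_on_curve, curve_of_zero⟩ :=
    GeodesicReturn.exists_local_defining_function smooth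
      (hasDerivAt_chart_comp he ((hγ.geodesic.smooth t₀).mdifferentiableAt (by simp)) hx₀e)
      lift_ne_zero
  refine ⟨f, hf, by rwa [hγ.velocityField_apply], ?_⟩
  filter_upwards [e.open_source.mem_nhds hx₀e,
    eventually_nhdsWithin_iff.1 (hγ.nhdsWithin_range_le_map_nhds t₀
      (show {x | f (e x) = 0} ∈ map γ (𝓝 t₀) from zero_on_curve)),
    (e.continuousAt hx₀e).eventually (curve_of_zero _
      (hγ.geodesic.smooth.continuous.continuousAt (e.open_source.mem_nhds hx₀e)))]
    with x hx zero_on_curve curve_of_zero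
  refine ⟨zero_on_curve, fun eq_zero => ?_⟩
  obtain ⟨t, ht, eq⟩ := curve_of_zero eq_zero
  exact ⟨t, e.injOn ht hx eq⟩

namespace IsGeodesicFlow

theorem tangentLift_orbit (hΦ : IsGeodesicFlow Φ) (v : UnitTangent M) (t : ℝ) :
    tangentLift (fun s => (Φ s v).1.proj) t = (Φ t v).1 :=
  ((hΦ v).2 t).symm

theorem hasDerivAt_comp_chart (hΦ : IsGeodesicFlow Φ)
    (he : e ∈ IsManifold.maximalAtlas (𝓡 2) ∞ M) {v : UnitTangent M} (hv : v.1.proj ∈ e.source)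
    {f : Plane → ℝ} (hf : DifferentiableAt ℝ f (e v.1.proj)) :
    HasDerivAt (fun s => f (e (Φ s v).1.proj)) (fderiv ℝ f (e v.1.proj) (coordVec e v.1)) 0 := by
  have start : Φ 0 v = v := Φ.map_zero_apply v
  have orbit := hasDerivAt_chart_comp he (t := 0)
    (((hΦ v).1.smooth 0).mdifferentiableAt (by simp)) (by rwa [start])
  rw [hΦ.tangentLift_orbit, start] at orbit
  exact HasFDerivAt.comp_hasDerivAt (0 : ℝ) (by rw [start]; exact hf.hasFDerivAt) orbit

variable [T2Space M]

theorem exists_isCrossingFunction (hΦ : IsGeodesicFlow Φ) (h𝒜 : IsOrientedAtlas 𝒜)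
    (hγ : IsSimpleClosedGeodesic γ ℓ) {v : UnitTangent M} (hv : v ∈ annulus 𝒜 γ) :
    ∃ W ∈ 𝓝 v, ∃ φ, IsCrossingFunction Φ (annulus 𝒜 γ) W φ := by
  have along := annulus_subset_unitAlong hv
  obtain ⟨e, he, hve⟩ := h𝒜.covers v.1.proj
  obtain ⟨f, hf, fderiv_eq, mem_range_iff⟩ :=
    hγ.exists_local_defining_function (h𝒜.1 he) along hve
  have proj := continuous_unitTangent_proj.continuousAt (x := v)
  have chart : ContinuousAt (fun v : UnitTangent M => e v.1.proj) v :=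
    ContinuousAt.comp (f := fun v : UnitTangent M => v.1.proj) (e.continuousAt hve) proj
  have speed_pos : 0 < fderiv ℝ f (e v.1.proj) (coordVec e v.1) := by
    rw [fderiv_eq]
    exact (mem_annulus_iff h𝒜 hγ he along hve).1 hv
  have speed : ContinuousAt (fun v : UnitTangent M => fderiv ℝ f (e v.1.proj) (coordVec e v.1)) v :=
    (ContinuousAt.comp (f := fun v : UnitTangent M => e v.1.proj)
      (hf.fderiv_right (m := 0) (by simp)).continuousAt chart).clm_apply
      (continuousAt_coordVec_unitTangent (h𝒜.1 he) hve)
  have eventually : ∀ᶠ u : UnitTangent M in 𝓝 v, u.1.proj ∈ e.source ∧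
      ContDiffAt ℝ 1 f (e u.1.proj) ∧ 0 < fderiv ℝ f (e u.1.proj) (coordVec e u.1) ∧
      (u.1.proj ∈ range γ ↔ f (e u.1.proj) = 0) ∧ (u ∈ unitAlong γ → u ∈ annulus 𝒜 γ) := by
    filter_upwards [proj (e.open_source.mem_nhds hve), chart.eventually (hf.eventually (by simp)),
      speed.eventually (lt_mem_nhds speed_pos), proj.eventually mem_range_iff,
      eventually_nhdsWithin_iff.1 (eventually_mem_annulus h𝒜 hγ hv)]
      with u hue hf speed_pos mem_range_iff mem_annulus
    exact ⟨hue, hf, speed_pos, mem_range_iff, mem_annulus⟩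
  refine ⟨_, eventually, fun v => f (e v.1.proj), ?_, ?_, ?_⟩
  · rintro u ⟨-, -, -, mem_range_iff, mem_annulus⟩
    exact ⟨fun hu => mem_range_iff.1 (annulus_subset_unitAlong hu),
      fun eq_zero => mem_annulus (mem_range_iff.2 eq_zero)⟩
  · rintro u ⟨hue, hf, speed_pos, -⟩
    exact ⟨_, speed_pos,
      hΦ.hasDerivAt_comp_chart (h𝒜.1 he) hue (hf.differentiableAt one_ne_zero)⟩
  · rintro u ⟨hue, hf, -⟩
    exact ContinuousAt.comp (f := fun v : UnitTangent M => e v.1.proj) hf.continuousAt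
      (ContinuousAt.comp (f := fun v : UnitTangent M => v.1.proj) (e.continuousAt hue)
        continuous_unitTangent_proj.continuousAt)

theorem flow_eq [IsContMDiffRiemannianBundle (𝓡 2) ∞ Plane (fun x : M => TangentSpace (𝓡 2) x)]
    (hΦ : IsGeodesicFlow Φ) {σ : ℝ → M} (hσ : IsGeodesic σ) {v : UnitTangent M} {s : ℝ}
    (hv : v.1 = tangentLift σ s) (t : ℝ) : (Φ t v).1 = tangentLift σ (t + s) := by
  have eq_at_s : tangentLift (fun r => (Φ r (Φ (-s) v)).1.proj) s = tangentLift σ s := by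
    rw [hΦ.tangentLift_orbit, ← hv, ← Φ.map_add, add_neg_cancel, Φ.map_zero_apply]
  rw [← (hΦ (Φ (-s) v)).1.tangentLift_eq hσ eq_at_s, hΦ.tangentLift_orbit, ← Φ.map_add,
    add_neg_cancel_right]

end IsGeodesicFlow

end GeodesicFlow

/-! ### The closed annulus as a polar collapse -/

section UnitTangentCompact

variable {M : Type*} [TopologicalSpace M] [ChartedSpace Plane M] [IsManifold (𝓡 2) ∞ M]
  [RiemannianBundle (fun x : M => TangentSpace (𝓡 2) x)]
  [IsContMDiffRiemannianBundle (𝓡 2) ∞ Plane (fun x : M => TangentSpace (𝓡 2) x)]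

theorem isContinuousRiemannianBundle_tangentSpace :
    IsContinuousRiemannianBundle Plane (fun x : M => TangentSpace (𝓡 2) x) := by
  obtain ⟨g, smooth, inner_eq⟩ := IsContMDiffRiemannianBundle.exists_contMDiff
    (IB := 𝓡 2) (n := ∞) (F := Plane) (E := fun x : M => TangentSpace (𝓡 2) x)
  exact ⟨g, smooth.continuous, inner_eq⟩

theorem compactSpace_unitTangent [T2Space M] [CompactSpace M] : CompactSpace (UnitTangent M) :=
  have : IsContinuousRiemannianBundle Plane (fun x : M => TangentSpace (𝓡 2) x) :=
    isContinuousRiemannianBundle_tangentSpace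
  isCompact_iff_compactSpace.1 isCompact_setOf_norm_eq_one

end UnitTangentCompact

section Collapse

variable {M : Type*} [TopologicalSpace M] [ChartedSpace Plane M] [IsManifold (𝓡 2) ∞ M]
  [RiemannianBundle (fun x : M => TangentSpace (𝓡 2) x)]
  {𝒜 : Set (OpenPartialHomeomorph M Plane)} {γ : ℝ → M} {ℓ : ℝ} {Φ : Flow ℝ (UnitTangent M)}

theorem angle_mem_Icc {V : Type*} [NormedAddCommGroup V] [InnerProductSpace ℝ V] (u w : V) :
    InnerProductGeometry.angle u w ∈ Icc 0 Real.pi :=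
  ⟨InnerProductGeometry.angle_nonneg u w, InnerProductGeometry.angle_le_pi u w⟩

theorem polarMap_eq_northPole_iff (hγ : IsSimpleClosedGeodesic γ ℓ) {v : UnitTangent M}
    (along : v ∈ unitAlong γ) : polarMap γ ℓ v = northPole ↔ v.1 ∈ range (tangentLift γ) := by
  have norm_field := hγ.norm_velocityField along
  have ne_zero : velocityField γ v.1.proj ≠ 0 := norm_ne_zero_iff.1 (by simp [norm_field])
  have ne_zero' : v.1.2 ≠ 0 := norm_ne_zero_iff.1 (by simp [v.2])
  rw [polarMap, spherePoint_eq_northPole_iff (angle_mem_Icc _ _),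
    ← InnerProductGeometry.inner_eq_mul_norm_iff_angle_eq_zero ne_zero ne_zero', norm_field, v.2,
    mul_one, inner_eq_one_iff_of_norm_eq_one norm_field v.2, mem_range_tangentLift_iff hγ,
    and_iff_right along, eq_comm]

theorem polarMap_eq_southPole_iff (hγ : IsSimpleClosedGeodesic γ ℓ) {v : UnitTangent M}
    (along : v ∈ unitAlong γ) :
    polarMap γ ℓ v = southPole ↔ v.1 ∈ range (tangentLift fun t => γ (-t)) := by
  have norm_field := hγ.norm_velocityField along
  have ne_zero : velocityField γ v.1.proj ≠ 0 := norm_ne_zero_iff.1 (by simp [norm_field])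
  have ne_zero' : v.1.2 ≠ 0 := norm_ne_zero_iff.1 (by simp [v.2])
  rw [polarMap, spherePoint_eq_southPole_iff (angle_mem_Icc _ _),
    ← InnerProductGeometry.inner_eq_neg_mul_norm_iff_angle_eq_pi ne_zero ne_zero', norm_field, v.2,
    mul_one, inner_eq_neg_one_iff_of_norm_eq_one norm_field v.2,
    mem_range_tangentLift_comp_neg_iff hγ, and_iff_right along, eq_neg_iff_add_eq_zero,
    eq_neg_iff_add_eq_zero, add_comm]

theorem IsPositivePair.angle_mem_Ioo {x : M} {u w : TangentSpace (𝓡 2) x}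
    (pos : IsPositivePair 𝒜 x u w) : InnerProductGeometry.angle u w ∈ Ioo 0 Real.pi := by
  obtain ⟨e, -, -, area⟩ := pos
  exact angle_mem_Ioo_of_cross_ne_zero (L := (mfderiv (𝓡 2) (𝓡 2) e x).toLinearMap) area.ne'

theorem mem_annulus_iff_polarMap (hγ : IsSimpleClosedGeodesic γ ℓ) (v : UnitTangent M) :
    v ∈ annulus 𝒜 γ ↔
      v ∈ closedAnnulus 𝒜 γ ∧ polarMap γ ℓ v ∉ ({northPole, southPole} : Set S2) := by
  refine ⟨fun hv => ⟨.inl hv, ?_⟩, fun ⟨mem, off_poles⟩ => ?_⟩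
  · exact (spherePoint_notMem_poles_iff (angle_mem_Icc _ _)).2
      ((mem_annulus_iff_isPositivePair hγ).1 hv).2.angle_mem_Ioo
  · have along := closedAnnulus_subset_unitAlong mem
    rw [mem_insert_iff, mem_singleton_iff, polarMap_eq_northPole_iff hγ along,
      polarMap_eq_southPole_iff hγ along] at off_poles
    exact mem.resolve_right off_poles

theorem IsPositivePair.eq_of_angle_eq (h𝒜 : IsOrientedAtlas 𝒜) {x : M}
    {u w w' : TangentSpace (𝓡 2) x} (hu : ‖u‖ = 1) (hw : ‖w‖ = 1) (hw' : ‖w'‖ = 1)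
    (pos : IsPositivePair 𝒜 x u w) (pos' : IsPositivePair 𝒜 x u w')
    (angle_eq : InnerProductGeometry.angle u w = InnerProductGeometry.angle u w') : w = w' := by
  obtain ⟨e, he, hx⟩ := h𝒜.covers x
  have inner_eq : inner ℝ u w = inner ℝ u w' := by
    rw [← InnerProductGeometry.cos_angle_mul_norm_mul_norm, angle_eq, hw, ← hw',
      InnerProductGeometry.cos_angle_mul_norm_mul_norm]
  exact eq_of_inner_eq_of_cross_pos (L := (mfderiv (𝓡 2) (𝓡 2) e x).toLinearMap)
    ((mdifferentiable_of_mem_maximalAtlas (h𝒜.1 he)).mfderiv_bijective hx) hu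
    (hw.trans hw'.symm) inner_eq ((isPositivePair_iff h𝒜 he hx u w).1 pos)
    ((isPositivePair_iff h𝒜 he hx u w').1 pos')

theorem injOn_polarMap (h𝒜 : IsOrientedAtlas 𝒜) (hγ : IsSimpleClosedGeodesic γ ℓ) :
    InjOn (polarMap γ ℓ) (annulus 𝒜 γ) := by
  intro v hv v' hv' eq
  obtain ⟨along, pos⟩ := (mem_annulus_iff_isPositivePair hγ).1 hv
  obtain ⟨along', pos'⟩ := (mem_annulus_iff_isPositivePair hγ).1 hv'
  obtain ⟨angle_eq, k, longitude_eq⟩ := spherePoint_inj pos.angle_mem_Ioo pos'.angle_mem_Ioo eq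
  have base_eq : v.1.proj = v'.1.proj := by
    have time_eq :
        Function.invFun γ v'.1.proj = Function.invFun γ v.1.proj + k * ℓ := by
      have := hγ.length_pos.ne'
      field_simp at longitude_eq
      linarith
    rw [← Function.invFun_eq along, ← Function.invFun_eq along', time_eq,
      hγ.periodic.int_mul k]
  obtain ⟨⟨x, w⟩, hw⟩ := v
  obtain ⟨⟨x', w'⟩, hw'⟩ := v'
  obtain rfl : x = x' := base_eq
  exact Subtype.ext (congrArg (TotalSpace.mk x)
    (pos.eq_of_angle_eq h𝒜 (hγ.norm_velocityField along) hw hw' pos' angle_eq))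

theorem exists_isPositivePair_angle_eq (h𝒜 : IsOrientedAtlas 𝒜) {x : M} {u : TangentSpace (𝓡 2) x}
    (hu : ‖u‖ = 1) {α : ℝ} (hα : α ∈ Ioo 0 Real.pi) :
    ∃ w, ‖w‖ = 1 ∧ InnerProductGeometry.angle u w = α ∧ IsPositivePair 𝒜 x u w := by
  obtain ⟨e, he, hx⟩ := h𝒜.covers x
  obtain ⟨w, norm_w, angle_eq, area⟩ := exists_angle_eq_and_cross_pos
    (L := (mfderiv (𝓡 2) (𝓡 2) e x).toLinearMap)
    ((mdifferentiable_of_mem_maximalAtlas (h𝒜.1 he)).mfderiv_bijective hx) hu hα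
  exact ⟨w, norm_w, angle_eq, (isPositivePair_iff h𝒜 he hx u w).2 area⟩

theorem surjOn_polarMap (h𝒜 : IsOrientedAtlas 𝒜) (hγ : IsSimpleClosedGeodesic γ ℓ) :
    SurjOn (polarMap γ ℓ) (closedAnnulus 𝒜 γ) univ := by
  intro y _
  have unit_lift {σ : ℝ → M} (hσ : IsGeodesic σ) : ‖(tangentLift σ 0).2‖ = 1 := hσ.unit_speed 0
  by_cases pole : y ∈ ({northPole, southPole} : Set S2)
  · rcases pole with rfl | rfl
    · exact ⟨⟨tangentLift γ 0, unit_lift hγ.geodesic⟩, .inr (.inl (mem_range_self 0)),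
        (polarMap_eq_northPole_iff hγ (mem_range_self 0)).2 (mem_range_self 0)⟩
    · exact ⟨⟨tangentLift (fun t => γ (-t)) 0, unit_lift hγ.geodesic.comp_neg⟩,
        .inr (.inr (mem_range_self 0)),
        (polarMap_eq_southPole_iff hγ (mem_range_self (-0))).2 (mem_range_self 0)⟩
  obtain ⟨α, hα, β, -, rfl⟩ := exists_spherePoint_eq y
  have off_poles := (spherePoint_notMem_poles_iff hα).1 pole
  obtain ⟨w, norm_w, angle_eq, pos⟩ := exists_isPositivePair_angle_eq h𝒜
    (hγ.geodesic.unit_speed (ℓ * β / (2 * Real.pi))) off_poles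
  refine ⟨⟨⟨_, w⟩, norm_w⟩, .inl ⟨_, w, rfl, pos⟩, ?_⟩
  rw [polarMap_eq hγ rfl, angle_eq, mul_div_cancel₀ _ Real.two_pi_pos.ne',
    mul_div_cancel_left₀ _ hγ.length_pos.ne']

variable [T2Space M]
  [IsContMDiffRiemannianBundle (𝓡 2) ∞ Plane (fun x : M => TangentSpace (𝓡 2) x)]

theorem IsGeodesicFlow.flow_mem_range_tangentLift (hΦ : IsGeodesicFlow Φ) {σ : ℝ → M}
    (hσ : IsGeodesic σ) {v : UnitTangent M} (hv : v.1 ∈ range (tangentLift σ)) (t : ℝ) :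
    (Φ t v).1 ∈ range (tangentLift σ) := by
  obtain ⟨s, hs⟩ := hv
  exact ⟨t + s, (hΦ.flow_eq hσ hs.symm t).symm⟩

theorem IsGeodesicFlow.polarMap_flow_eq (hΦ : IsGeodesicFlow Φ) (hγ : IsSimpleClosedGeodesic γ ℓ)
    {v : UnitTangent M} (hv : v ∈ closedAnnulus 𝒜 γ)
    (pole : polarMap γ ℓ v ∈ ({northPole, southPole} : Set S2)) (t : ℝ) :
    Φ t v ∈ closedAnnulus 𝒜 γ ∧ polarMap γ ℓ (Φ t v) = polarMap γ ℓ v := by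
  have along := closedAnnulus_subset_unitAlong hv
  rcases pole with north | south
  · have mem := hΦ.flow_mem_range_tangentLift hγ.geodesic
      ((polarMap_eq_northPole_iff hγ along).1 north) t
    have mem_closed : Φ t v ∈ closedAnnulus 𝒜 γ := .inr (.inl mem)
    exact ⟨mem_closed, north ▸
      (polarMap_eq_northPole_iff hγ (closedAnnulus_subset_unitAlong mem_closed)).2 mem⟩
  · have mem := hΦ.flow_mem_range_tangentLift hγ.geodesic.comp_neg
      ((polarMap_eq_southPole_iff hγ along).1 south) t
    have mem_closed : Φ t v ∈ closedAnnulus 𝒜 γ := .inr (.inr mem)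
    exact ⟨mem_closed, south ▸
      (polarMap_eq_southPole_iff hγ (closedAnnulus_subset_unitAlong mem_closed)).2 mem⟩

variable [CompactSpace M]

theorem IsGeodesicFlow.isPolarCollapse (hΦ : IsGeodesicFlow Φ) (h𝒜 : IsOrientedAtlas 𝒜)
    (hγ : IsSimpleClosedGeodesic γ ℓ) :
    IsPolarCollapse Φ (annulus 𝒜 γ) (closedAnnulus 𝒜 γ) (polarMap γ ℓ) {northPole, southPole} where
  isCompact :=
    have : CompactSpace (UnitTangent M) := compactSpace_unitTangent
    (isClosed_closedAnnulus h𝒜 hγ).isCompact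
  isClosed := (toFinite _).isClosed
  continuousOn :=
    have : IsContinuousRiemannianBundle Plane (fun x : M => TangentSpace (𝓡 2) x) :=
      isContinuousRiemannianBundle_tangentSpace
    (continuousOn_polarMap hγ).mono closedAnnulus_subset_unitAlong
  surjOn := surjOn_polarMap h𝒜 hγ
  mem_iff := mem_annulus_iff_polarMap hγ
  injOn := injOn_polarMap h𝒜 hγ
  invariant _ hv pole t := hΦ.polarMap_flow_eq hγ hv pole t

end Collapse

end GeodesicReturn

end

theorem proposition3p1 {M : Type*} [TopologicalSpace M] [T2Space M] [CompactSpace M]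
    [ChartedSpace GeodesicReturn.Plane M] [IsManifold (𝓡 2) ∞ M]
    [RiemannianBundle (fun x : M => TangentSpace (𝓡 2) x)]
    [IsContMDiffRiemannianBundle (𝓡 2) ∞ GeodesicReturn.Plane
      (fun x : M => TangentSpace (𝓡 2) x)]
    (𝒜 : Set (OpenPartialHomeomorph M GeodesicReturn.Plane))
    (h𝒜 : GeodesicReturn.IsOrientedAtlas 𝒜)
    (Φ : Flow ℝ (GeodesicReturn.UnitTangent M)) (hΦ : GeodesicReturn.IsGeodesicFlow Φ)
    (hequi : GeodesicReturn.IsEquicontinuousFlow Φ)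
    (γ : ℝ → M) (ℓ : ℝ) (hγ : GeodesicReturn.IsSimpleClosedGeodesic γ ℓ) :
    -- `S²` is the two-point compactification of the annulus
    IsOpenEmbedding (GeodesicReturn.annulusToSphere 𝒜 γ ℓ) ∧
    range (GeodesicReturn.annulusToSphere 𝒜 γ ℓ) =
      {GeodesicReturn.northPole, GeodesicReturn.southPole}ᶜ ∧
    -- the return map exists, and its extension to `S²` is a recurrent homeomorphism
    ∃ (F : GeodesicReturn.annulus 𝒜 γ → GeodesicReturn.annulus 𝒜 γ)
      (F' : GeodesicReturn.S2 ≃ₜ GeodesicReturn.S2),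
      GeodesicReturn.IsFirstReturnMap Φ (GeodesicReturn.annulus 𝒜 γ) F ∧
      (∀ v, F' (GeodesicReturn.annulusToSphere 𝒜 γ ℓ v) =
        GeodesicReturn.annulusToSphere 𝒜 γ ℓ (F v)) ∧
      F' GeodesicReturn.northPole = GeodesicReturn.northPole ∧
      F' GeodesicReturn.southPole = GeodesicReturn.southPole ∧
      GeodesicReturn.IsRecurrent F' := by
  have := GeodesicReturn.compactSpace_unitTangent (M := M)
  obtain ⟨F, F', return_map, extends_F, fixed, recurrent⟩ :=
    (hΦ.isPolarCollapse h𝒜 hγ).exists_returnMap_extension hequi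
      (fun _ hv => hΦ.exists_isCrossingFunction h𝒜 hγ hv)
      GeodesicReturn.isExhaustedByContinua_compl_poles
  rw [funext (GeodesicReturn.annulusToSphere_eq_polarMap hγ)]
  exact ⟨(hΦ.isPolarCollapse h𝒜 hγ).isOpenEmbedding, (hΦ.isPolarCollapse h𝒜 hγ).range_eq, F, F',
    return_map, extends_F, fixed _ (.inl rfl), fixed _ (.inr rfl), recurrent⟩
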